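/- Let $a_1,a_2$ be nonzero integers and let $u=(u_n)_{n\ge 0}$ be the Lucas sequence $u_0=0$, $u_1=1$, $u_n=a_1u_{n-1}+a_2u_{n-2}$ for $n\ge 2$. Put $D_u=a_1^2+4a_2$, let $\alpha,\beta$ be the two complex roots of $X^2-a_1X-a_2$, and put $\gamma=\alpha/\beta$ and $K=\mathbb{Q}(\sqrt{D_u})$. Assume that $u$ is nondegenerate (that is, $\gamma$ is not a root of unity), that $D_u$ is not a square, and that the discriminant of $K$ is neither $-3$ nor $-4$. For each positive integer $n$, let $\zeta_n=e^{2\pi i/n}$, let $\gamma^{1/n}$ be a fixed $n$th root of $\gamma$, and let $K_n=K(\zeta_n,\gamma^{1/n})$. Let $C_n\subseteq\mathrm{Gal}(K_n/\mathbb{Q})$ consist of the identity and of the automorphism $\sigma$ with $\sigma(\zeta_n)=\zeta_n^{-1}$ and $\sigma(\gamma^{1/n})=\gamma^{-1/n}$, if such a $\sigma$ exists. For each positive integer $t$ put $$\delta_u(t)=\sum_{n=1}^{\infty}\frac{\mu(n)\,\#C_{nt}}{[K_{nt}:\mathbb{Q}]},$$ where $\mu$ is the Möbius function. Let $$A=\prod_p\left(1-\frac{1}{p(p-1)}\right)$$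 be the Artin constant and, for positive integers $h,t$, let $$F_h(t)=\frac{(t,h)}{\varphi(t)\,t}\prod_{\substack{p>2\\ p\mid t}}\left(1-\frac{(pt,h)}{p^2(t,h)}\right)\left(1-\frac{(p,h)}{p(p-1)}\right)^{-1},$$ where $p$ runs over primes, $(\cdot,\cdot)$ is the greatest common divisor and $\varphi$ is the Euler totient function. Then the series defining $\delta_u(t)$ converges absolutely for every positive integer $t$, and there exist a positive integer $h$ and a periodic function $G_u$ with rational values such that $F_{2h}$ is multiplicative and $$\delta_u(t)=A\,F_{2h}(t)\,G_u(t)\qquad\text{for every positive integer } t.$$ -/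

import Mathlib

noncomputable section

namespace LucasIndex

/-- `u` is the Lucas sequence with (nonzero) integer parameters `a₁`, `a₂`. -/
structure IsLucasSequence (a₁ a₂ : ℤ) (u : ℕ → ℤ) : Prop where
  a₁_ne_zero : a₁ ≠ 0
  a₂_ne_zero : a₂ ≠ 0
  zero : u 0 = 0
  one : u 1 = 1
  recurrence : ∀ n, u (n + 2) = a₁ * u (n + 1) + a₂ * u n

/-- The discriminant `D = a₁² + 4 a₂` of the characteristic polynomial `X² - a₁ X - a₂`. -/
def D (a₁ a₂ : ℤ) : ℤ := a₁ ^ 2 + 4 * a₂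

/-- A complex square root of `D`. -/
def sqrtD (a₁ a₂ : ℤ) : ℂ := (D a₁ a₂ : ℂ) ^ (1 / 2 : ℂ)

/-- The first root of the characteristic polynomial. -/
def α (a₁ a₂ : ℤ) : ℂ := (a₁ + sqrtD a₁ a₂) / 2

/-- The second root of the characteristic polynomial. -/
def β (a₁ a₂ : ℤ) : ℂ := (a₁ - sqrtD a₁ a₂) / 2

/-- The ratio of the two roots. -/
def γ (a₁ a₂ : ℤ) : ℂ := α a₁ a₂ / β a₁ a₂

/-- The Lucas sequence is nondegenerate when the ratio `γ` is not a root of unity. -/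
def Nondegenerate (a₁ a₂ : ℤ) : Prop := ∀ n : ℕ, 0 < n → γ a₁ a₂ ^ n ≠ 1

/-- The field `K = ℚ(√D)`, inside `ℂ`. -/
def K (a₁ a₂ : ℤ) : IntermediateField ℚ ℂ := IntermediateField.adjoin ℚ {sqrtD a₁ a₂}

theorem sqrtD_sq (a₁ a₂ : ℤ) : sqrtD a₁ a₂ ^ 2 = (D a₁ a₂ : ℂ) := by
  have h := Complex.cpow_nat_inv_pow (D a₁ a₂ : ℂ) (n := 2) (by norm_num)
  simpa only [sqrtD, Nat.cast_ofNat, one_div] using h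

theorem isIntegral_sqrtD (a₁ a₂ : ℤ) : IsIntegral ℚ (sqrtD a₁ a₂) := by
  refine IsIntegral.of_pow (n := 2) (by norm_num) ?_
  rw [sqrtD_sq]
  have : ((D a₁ a₂ : ℤ) : ℂ) = algebraMap ℚ ℂ (D a₁ a₂ : ℚ) := by simp
  rw [this]
  exact isIntegral_algebraMap

instance (a₁ a₂ : ℤ) : NumberField (K a₁ a₂) where
  to_charZero := inferInstance
  to_finiteDimensional := IntermediateField.adjoin.finiteDimensional (isIntegral_sqrtD a₁ a₂)

/-- The primitive `n`th root of unity `ζ_n = exp (2 π i / n)`. -/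
def ζ (n : ℕ) : ℂ := Complex.exp (2 * Real.pi * Complex.I / n)

/-- A fixed `n`th root of `γ`. -/
def γroot (a₁ a₂ : ℤ) (n : ℕ) : ℂ := γ a₁ a₂ ^ (1 / n : ℂ)

/-- The field `K_n = K(ζ_n, γ^{1/n})`, as an extension of `ℚ` inside `ℂ`. -/
def Kn (a₁ a₂ : ℤ) (n : ℕ) : IntermediateField ℚ ℂ :=
  IntermediateField.adjoin ℚ {sqrtD a₁ a₂, ζ n, γroot a₁ a₂ n}

/-- `ζ_n` as an element of `K_n`. -/
def ζK (a₁ a₂ : ℤ) (n : ℕ) : Kn a₁ a₂ n :=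
  ⟨ζ n, IntermediateField.subset_adjoin _ _ (by simp)⟩

/-- `γ^{1/n}` as an element of `K_n`. -/
def γrootK (a₁ a₂ : ℤ) (n : ℕ) : Kn a₁ a₂ n :=
  ⟨γroot a₁ a₂ n, IntermediateField.subset_adjoin _ _ (by simp)⟩

/-- The subset `C_n` of `Gal(K_n / ℚ)`: the identity, together with the automorphism that inverts
both `ζ_n` and `γ^{1/n}` if it exists (when `D` is not a square and `γ` is not a root of unity, `K`
is `ℚ(γ)`, so that there is at most one such automorphism). -/
def Cn (a₁ a₂ : ℤ) (n : ℕ) : Set (Kn a₁ a₂ n ≃ₐ[ℚ] Kn a₁ a₂ n) :=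
  {1} ∪ {σ | σ (ζK a₁ a₂ n) = (ζK a₁ a₂ n)⁻¹ ∧ σ (γrootK a₁ a₂ n) = (γrootK a₁ a₂ n)⁻¹}

/-- The term `μ(n) #C_{nt} / [K_{nt} : ℚ]` (which is `0` for `n = 0`, since `μ 0 = 0`). -/
def δterm (a₁ a₂ : ℤ) (t n : ℕ) : ℝ :=
  (ArithmeticFunction.moebius n : ℝ) * ((Cn a₁ a₂ (n * t)).ncard : ℝ) / (Module.finrank ℚ (Kn a₁ a₂ (n * t)) : ℝ)

/-- The constant `δ_u(t) = ∑_{n ≥ 1} μ(n) #C_{nt} / [K_{nt} : ℚ]`. -/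
def δ (a₁ a₂ : ℤ) (t : ℕ) : ℝ := ∑' n : ℕ, δterm a₁ a₂ t n

/-- The Artin constant `∏_p (1 - 1 / (p (p - 1)))`. -/
def artinConstant : ℝ := ∏' p : Nat.Primes, (1 - 1 / ((p : ℝ) * ((p : ℝ) - 1)))

/-- The product that defines the Artin constant converges. -/
theorem multipliable_artinConstant :
    Multipliable fun p : Nat.Primes => (1 - 1 / ((p : ℝ) * ((p : ℝ) - 1)) : ℝ) := by
  simp_rw [sub_eq_add_neg (1 : ℝ)]
  refine Real.multipliable_one_add_of_summable ?_
  refine Summable.neg ?_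
  have h : Summable fun n : ℕ => (2 / (n : ℝ) ^ 2 : ℝ) := by
    simpa [div_eq_mul_inv] using (Real.summable_nat_pow_inv.mpr (by norm_num : 1 < 2)).mul_left 2
  refine Summable.of_nonneg_of_le (fun p => ?_) (fun p => ?_)
    (h.comp_injective Nat.Primes.coe_nat_injective)
  · have h2 : (2 : ℝ) ≤ (p : ℕ) := by exact_mod_cast p.2.two_le
    have h3 : (0 : ℝ) < (p : ℕ) - 1 := by linarith
    positivity
  · have h2 : (2 : ℝ) ≤ (p : ℕ) := by exact_mod_cast p.2.two_le
    have h3 : (0 : ℝ) < (p : ℕ) - 1 := by linarith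
    simp only [Function.comp]
    rw [div_le_div_iff₀ (by positivity) (by positivity)]
    nlinarith

/-- The arithmetic function
`F_h(t) = (t, h) / (φ(t) t) ∏_{p > 2, p ∣ t} (1 - (p t, h) / (p² (t, h))) (1 - (p, h) / (p (p - 1)))⁻¹`
of `t ≥ 1`. -/
def F (h : ℕ) : ArithmeticFunction ℝ where
  toFun t := (t.gcd h : ℝ) / ((t.totient : ℝ) * (t : ℝ)) *
    ∏ p ∈ t.primeFactors with 2 < p,
      (1 - ((p * t).gcd h : ℝ) / ((p : ℝ) ^ 2 * (t.gcd h : ℝ))) *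
        (1 - (p.gcd h : ℝ) / ((p : ℝ) * ((p : ℝ) - 1)))⁻¹
  map_zero' := by simp

end LucasIndex

end

/-! The degree of `Kn` and the size of `Cn` deviate from the generic Kummer situation only through
`gcd n M`, for a fixed `M`; the series is then an Euler product with finitely many altered factors.

Arithmetic input. If `Kn` has degree `n / d` over `K(ζ_n)`, then `γ` is a `d`-th power in `K(ζ_n)`.
As that field is abelian over `ℚ`, `γ ^ 24` is then a `d`-th power in `K` (`exists_pow_eq_γ_pow`),
and since `γ` is not a root of unity, `d` is bounded (`exists_bound_pow_eq`). So `2 φ(n) n / [K_n :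
ℚ]` is a bounded integer (`exists_defect`).

Passage to a finite level. Embeddings of `Kn` in `ℂ` correspond to the pairs of images of `(ζ_n,
γ^{1/n})`. At a level where the defect is maximal nothing more can be lost above it, so all
candidate pairs lying over a conjugate pair are conjugate (`exists_saturated_level`). Gluing at
coprime indices extends this to every `n`: the conjugate pairs of level `n` are the full preimage of
those of level `gcd n M` (`exists_level`).

Summation. Sort `n` by `d = gcd n M`. Only `n = d m` with `m` prime to `M` matter, and the sum over
`m` is the Artin constant times a finite product over `p ∣ M t` (`tsum_coprimeTerm`). The factors
with `p ∤ M` are those of `F`; everything else depends on `t` modulo `M` and forms `G`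
(`exists_periodic_moebius_sum`). The exponent `h` enters only through the requirement that `2h`
divide `M`. -/

/-! ### Möbius sums over integers prime to `M`, and the Artin constant -/

namespace LucasIndex

open Finset ArithmeticFunction

/-- The function `n ↦ φ(n) n`, the order of `ℤ/n ⋊ (ℤ/n)ˣ`. -/
def psi (n : ℕ) : ℕ := n.totient * n

theorem psi_pos {n : ℕ} (hn : 0 < n) : 0 < psi n :=
  Nat.mul_pos (Nat.totient_pos.2 hn) hn

theorem psi_dvd_psi {m n : ℕ} (h : m ∣ n) : psi m ∣ psi n :=
  mul_dvd_mul (Nat.totient_dvd_of_dvd h) h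

/-- The ratio `φ(t) t / (φ(d t) d t)`, in terms of `d` and `gcd d t` only. -/
def kap (d t : ℕ) : ℚ := ((d.gcd t).totient : ℚ) / (d.totient * d * d.gcd t)

theorem kap_eq {d t : ℕ} (hd : 0 < d) (ht : 0 < t) :
    kap d t = (psi t : ℚ) / psi (d * t) := by
  have h := Nat.totient_gcd_mul_totient_mul d t
  have hg : 0 < d.gcd t := Nat.gcd_pos_of_pos_left _ hd
  have h1 : (0 : ℚ) < (d.gcd t).totient := by exact_mod_cast Nat.totient_pos.2 hg
  have h2 : (0 : ℚ) < d.totient := by exact_mod_cast Nat.totient_pos.2 hd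
  have h3 : (0 : ℚ) < (d * t).totient := by exact_mod_cast Nat.totient_pos.2 (Nat.mul_pos hd ht)
  have h4 : (0 : ℚ) < d.gcd t := by exact_mod_cast hg
  have h5 : (0 : ℚ) < d := by exact_mod_cast hd
  have h6 : (0 : ℚ) < t := by exact_mod_cast ht
  have h' : ((d.gcd t).totient * (d * t).totient : ℚ) = d.totient * t.totient * d.gcd t := by
    exact_mod_cast h
  unfold kap psi
  push_cast
  rw [div_eq_div_iff (by positivity) (by positivity)]
  linear_combination (d * t : ℚ) * h'

theorem kap_mul {d m : ℕ} (h : d.Coprime m) (t : ℕ) :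
    kap (d * m) t = kap d t * kap m t := by
  have h1 : (d * m).gcd t = d.gcd t * m.gcd t := Nat.Coprime.mul_gcd h t
  have h2 : (d.gcd t).Coprime (m.gcd t) :=
    Nat.Coprime.coprime_dvd_left (Nat.gcd_dvd_left _ _)
      (Nat.Coprime.coprime_dvd_right (Nat.gcd_dvd_left _ _) h)
  unfold kap
  rw [h1, Nat.totient_mul h2, Nat.totient_mul h, div_mul_div_comm]
  push_cast
  congr 1
  ring

/-- This gives `psi n ≫ n ^ (3/2)`, hence absolute convergence. The extra 2 is lost only at the
prime 2, so at most once among coprime factors. -/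
theorem le_totient_sq (n : ℕ) : n ≤ n.totient ^ 2 * (if Even n then 2 else 1) := by
  induction n using Nat.recOnPosPrimePosCoprime with
  | zero => simp
  | one => simp
  | prime_pow p k hp hk =>
    obtain ⟨k, rfl⟩ : ∃ l, k = l + 1 := ⟨k - 1, by omega⟩
    rw [Nat.totient_prime_pow_succ hp]
    rcases hp.eq_two_or_odd' with rfl | hodd
    · have : Even (2 ^ (k + 1)) := by simp [Nat.even_pow]
      rw [if_pos this]
      have h1 : 1 ≤ 2 ^ k := Nat.one_le_two_pow
      norm_num [pow_succ]
      nlinarith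
    · have h3 : 3 ≤ p := by
        have := hp.two_le
        obtain ⟨r, hr⟩ := hodd
        omega
      have h1 : 1 ≤ p ^ k := Nat.one_le_pow _ _ hp.pos
      obtain ⟨q, rfl⟩ : ∃ q, p = q + 3 := ⟨p - 3, by omega⟩
      have : ¬ Even ((q + 3) ^ (k + 1)) := by
        rw [Nat.not_even_iff_odd]; exact hodd.pow
      rw [if_neg this, mul_one, pow_succ, mul_pow, pow_two ((q+3)^k)]
      have h2 : q + 3 ≤ (q + 3 - 1) ^ 2 := by
        have : q + 3 - 1 = q + 2 := by omega
        rw [this]; nlinarith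
      calc (q + 3) ^ k * (q + 3) ≤ ((q + 3) ^ k * (q + 3) ^ k) * (q + 3 - 1) ^ 2 :=
            Nat.mul_le_mul (Nat.le_mul_of_pos_left _ h1) h2
        _ = _ := rfl
  | coprime a b ha hb hab iha ihb =>
    rw [Nat.totient_mul hab]
    have : (if Even a then 2 else 1) * (if Even b then 2 else 1) ≤
        if Even (a * b) then 2 else 1 := by
      by_cases h1 : Even a <;> by_cases h2 : Even b <;> simp [Nat.even_mul, h1, h2]
      exact Nat.not_coprime_of_dvd_of_dvd one_lt_two h1.two_dvd h2.two_dvd hab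
    calc a * b ≤ _ := Nat.mul_le_mul iha ihb
      _ = (a.totient * b.totient) ^ 2 * ((if Even a then 2 else 1) * (if Even b then 2 else 1)) := by
        ring
      _ ≤ _ := Nat.mul_le_mul_left _ this

theorem summable_inv_psi : Summable fun n : ℕ => ((psi n : ℝ))⁻¹ := by
  have h : Summable fun n : ℕ => 2 * ((n : ℝ) ^ (3 / 2 : ℝ))⁻¹ :=
    (Real.summable_nat_rpow_inv.2 (by norm_num)).mul_left 2
  refine Summable.of_nonneg_of_le (fun n => by positivity) (fun n => ?_) h
  rcases Nat.eq_zero_or_pos n with rfl | hn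
  · simp [psi]
  have hn' : (0 : ℝ) < n := by exact_mod_cast hn
  have hp : (0 : ℝ) < psi n := by exact_mod_cast psi_pos hn
  have h1 : (n : ℝ) ≤ 2 * (n.totient : ℝ) ^ 2 := by
    have h := le_totient_sq n
    have h2 : n ≤ 2 * n.totient ^ 2 := by
      split_ifs at h <;> omega
    exact_mod_cast h2
  have h2 : (n : ℝ) ^ (3 / 2 : ℝ) ≤ 2 * psi n := by
    refine le_of_sq_le_sq ?_ (by positivity)
    rw [← Real.rpow_natCast, ← Real.rpow_mul hn'.le]
    have : ((3 / 2 : ℝ) * (2 : ℕ)) = (3 : ℕ) := by norm_num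
    rw [this, Real.rpow_natCast]
    have e : ((psi n : ℕ) : ℝ) = n.totient * n := by simp [psi]
    rw [e]
    have : (0 : ℝ) ≤ (n : ℝ) ^ 2 := by positivity
    nlinarith
  rw [inv_eq_one_div, div_le_iff₀ hp]
  have h3 : (0 : ℝ) < (n : ℝ) ^ (3 / 2 : ℝ) := by positivity
  rw [mul_assoc, inv_mul_eq_div, ← mul_div_assoc, le_div_iff₀ h3]
  linarith

/-- The local factor of the Artin constant. -/
def artinFactor (p : ℕ) : ℚ := 1 - 1 / ((p : ℚ) * ((p : ℚ) - 1))

theorem artinFactor_ne_zero {p : ℕ} (hp : p.Prime) : artinFactor p ≠ 0 := by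
  have h2 : (2 : ℚ) ≤ p := by exact_mod_cast hp.two_le
  have : (0 : ℚ) < p * (p - 1) := by nlinarith
  unfold artinFactor
  have h : (1 : ℚ) / (p * (p - 1)) ≤ 1 / 2 := by
    apply one_div_le_one_div_of_le <;> nlinarith
  intro h0
  linarith

/-- The terms of the Dirichlet-type series over the integers coprime to `M`. -/
def coprimeTerm (M t m : ℕ) : ℚ := if m.Coprime M then (moebius m : ℚ) * kap m t else 0

theorem coprimeTerm_mul {M t m n : ℕ} (h : m.Coprime n) :
    coprimeTerm M t (m * n) = coprimeTerm M t m * coprimeTerm M t n := by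
  unfold coprimeTerm
  rw [kap_mul h, isMultiplicative_moebius.map_mul_of_coprime h]
  by_cases h1 : m.Coprime M
  · by_cases h2 : n.Coprime M
    · rw [if_pos h1, if_pos h2, if_pos (Nat.Coprime.mul_left h1 h2)]
      push_cast
      ring
    · rw [if_neg h2, if_neg fun h' => h2 h'.coprime_mul_left, mul_zero]
  · rw [if_neg h1, if_neg fun h' => h1 h'.coprime_mul_right, zero_mul]

theorem coprimeTerm_prime {M t p : ℕ} (hp : p.Prime) :
    coprimeTerm M t p =
      if p ∣ M then 0 else if p ∣ t then -(1 / (p : ℚ) ^ 2) else -(1 / ((p : ℚ) * (p - 1))) := by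
  unfold coprimeTerm
  by_cases h : p ∣ M
  · rw [if_pos h, if_neg]
    rwa [hp.coprime_iff_not_dvd, not_not]
  rw [if_neg h, if_pos ((hp.coprime_iff_not_dvd).2 h), moebius_apply_prime hp]
  have h2 : (1 : ℚ) < p := by exact_mod_cast hp.one_lt
  have h3 : (p : ℚ) - 1 ≠ 0 := by linarith
  have h4 : (p : ℚ) ≠ 0 := by linarith
  unfold kap
  rw [Nat.totient_prime hp, Nat.cast_sub hp.one_le]
  by_cases h1 : p ∣ t
  · rw [if_pos h1, Nat.gcd_eq_left h1, Nat.totient_prime hp, Nat.cast_sub hp.one_le]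
    push_cast
    field_simp
  · rw [if_neg h1, (hp.coprime_iff_not_dvd).2 h1]
    push_cast
    field_simp
    simp

theorem summable_coprimeTerm (M t : ℕ) (ht : 0 < t) :
    Summable fun m : ℕ => ‖(coprimeTerm M t m : ℝ)‖ := by
  refine Summable.of_nonneg_of_le (fun n => norm_nonneg _) (fun n => ?_)
    (summable_inv_psi.mul_left (psi t : ℝ))
  rcases Nat.eq_zero_or_pos n with rfl | hn
  · simp [coprimeTerm, psi]
  have hp : (0 : ℝ) < psi n := by exact_mod_cast psi_pos hn
  have hp' : (0 : ℝ) < psi (n * t) := by exact_mod_cast psi_pos (Nat.mul_pos hn ht)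
  unfold coprimeTerm
  split_ifs
  · rw [kap_eq hn ht]
    push_cast
    rw [norm_mul]
    have h1 : ‖((moebius n : ℤ) : ℝ)‖ ≤ 1 := by
      rw [Real.norm_eq_abs]
      exact_mod_cast abs_moebius_le_one
    have h2 : ‖(psi t : ℝ) / psi (n * t)‖ ≤ psi t * (psi n : ℝ)⁻¹ := by
      rw [Real.norm_of_nonneg (by positivity), div_eq_mul_inv]
      gcongr
      exact Nat.le_of_dvd (psi_pos (Nat.mul_pos hn ht)) (psi_dvd_psi (Dvd.intro _ rfl))
    calc _ ≤ 1 * ‖(psi t : ℝ) / psi (n * t)‖ := by gcongr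
      _ ≤ _ := by simpa using h2
  · simp
    positivity

/-- The ratio of the local factors of `∑ μ(m) φ(t) t / (φ(m t) m t)` (over `m` coprime to `M`) and
of the Artin constant. -/
def localRatio (M p : ℕ) : ℚ :=
  if p ∣ M then (artinFactor p)⁻¹ else (1 - 1 / (p : ℚ) ^ 2) * (artinFactor p)⁻¹

/-- Since `μ` kills higher prime powers, the Euler factor at `p` is `1 + coprimeTerm M t p`. For `p
∤ M t` this is exactly the Artin factor, so only finitely many factors need correction. -/
theorem tsum_coprimeTerm (M t : ℕ) (hM : 0 < M) (ht : 0 < t) :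
    ∑' m : ℕ, (coprimeTerm M t m : ℝ) =
      artinConstant * (∏ p ∈ (M * t).primeFactors, localRatio M p : ℚ) := by
  have hE := EulerProduct.eulerProduct_hasProd (f := fun m => (coprimeTerm M t m : ℝ))
    (by simp [coprimeTerm, kap]) (fun {m n} h => by rw [coprimeTerm_mul h]; push_cast; rfl)
    (summable_coprimeTerm M t ht) (by simp [coprimeTerm])
  have hloc : ∀ p : Nat.Primes, ∑' e : ℕ, (coprimeTerm M t ((p : ℕ) ^ e) : ℝ) =
      1 + (coprimeTerm M t p : ℝ) := by
    intro p
    rw [tsum_eq_sum (s := range 2)]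
    · simp [sum_range_succ, coprimeTerm, kap]
    · intro e he
      have he : e ≠ 0 ∧ e ≠ 1 := by simp at he; omega
      simp [coprimeTerm, moebius_apply_prime_pow p.2 he.1, he.2]
  simp_rw [hloc] at hE
  have hA : HasProd (fun p : Nat.Primes => (1 - 1 / ((p : ℝ) * ((p : ℝ) - 1)) : ℝ))
    artinConstant := multipliable_artinConstant.hasProd
  set s : Finset Nat.Primes := (M * t).primeFactors.subtype Nat.Prime
  have hW : HasProd (fun p : Nat.Primes => if p ∈ s then (localRatio M p : ℝ) else 1)
      (∏ p ∈ s, if p ∈ s then (localRatio M p : ℝ) else 1) :=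
    hasProd_prod_of_ne_finset_one fun p hp => if_neg hp
  have hs : (∏ p ∈ s, if p ∈ s then (localRatio M p : ℝ) else 1) =
      (∏ p ∈ (M * t).primeFactors, localRatio M p : ℚ) := by
    rw [prod_congr rfl fun p hp => if_pos hp]
    push_cast
    exact prod_subtype_of_mem (fun p : ℕ => (localRatio M p : ℝ))
      fun p hp => Nat.prime_of_mem_primeFactors hp
  rw [hs] at hW
  have hAW := hA.mul hW
  suffices hfun : (fun p : Nat.Primes => 1 + (coprimeTerm M t p : ℝ)) = fun p : Nat.Primes =>
      (1 - 1 / ((p : ℝ) * ((p : ℝ) - 1)) : ℝ) * if p ∈ s then (localRatio M p : ℝ) else 1 by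
    rw [hfun] at hE
    exact hE.unique hAW
  funext p
  have hp := p.2
  have ha : (1 - 1 / ((p : ℝ) * ((p : ℝ) - 1)) : ℝ) = (artinFactor p : ℝ) := by
    simp [artinFactor]
  have hne : (artinFactor p : ℝ) ≠ 0 := by exact_mod_cast artinFactor_ne_zero hp
  have hmem : p ∈ s ↔ (p : ℕ) ∣ M ∨ (p : ℕ) ∣ t := by
    refine (mem_subtype (s := (M * t).primeFactors)).trans ?_
    rw [Nat.mem_primeFactors_of_ne_zero (by positivity)]
    exact (and_iff_right hp).trans hp.dvd_mul
  rw [ha, coprimeTerm_prime hp]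
  by_cases h1 : (p : ℕ) ∣ M
  · rw [if_pos (hmem.2 (Or.inl h1))]
    simp [localRatio, h1, hne]
  · by_cases h2 : (p : ℕ) ∣ t
    · rw [if_pos (hmem.2 (Or.inr h2))]
      simp only [localRatio, h1, h2, if_true, if_false]
      push_cast
      field_simp
      ring
    · rw [if_neg (c := p ∈ s) fun h => (hmem.1 h).elim h1 h2]
      simp only [h1, h2, if_false]
      rw [← ha]
      push_cast
      ring

end LucasIndex

/-! ### Splitting the Möbius sum by `gcd n M`; the function `F` and the periodic factor -/

namespace LucasIndex

open Finset ArithmeticFunction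

theorem gcd_mul_eq_of_dvd {M d m t : ℕ} (hm : m.Coprime M) :
    (d * m * t).gcd M = (d * t).gcd M := by
  rw [mul_right_comm]
  exact Nat.Coprime.gcd_mul_right_cancel _ hm

theorem hasSum_fiber {M t d : ℕ} (hM : 0 < M) (ht : 0 < t) (hd : d ∣ M) (c : ℕ → ℚ) :
    HasSum (fun n : ℕ => if n.gcd M = d then
        (moebius n : ℝ) * (c ((n * t).gcd M) / psi (n * t)) else 0)
      ((moebius d * c ((d * t).gcd M) * kap d t / psi t : ℚ) *
        ∑' m : ℕ, (coprimeTerm M t m : ℝ)) := by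
  have hd0 : 0 < d := Nat.pos_of_dvd_of_pos hd hM
  have h := ((summable_coprimeTerm M t ht).of_norm.hasSum).mul_left
    ((moebius d * c ((d * t).gcd M) * kap d t / psi t : ℚ) : ℝ)
  have hinj : Function.Injective fun m : ℕ => d * m := mul_right_injective₀ hd0.ne'
  rw [← hinj.hasSum_iff]
  · refine (congrArg (HasSum · _) (funext fun m => ?_)).mpr h
    show (if (d * m).gcd M = d then _ else _) = _ * ((coprimeTerm M t m : ℚ) : ℝ)
    unfold coprimeTerm
    by_cases hm : m.Coprime M
    · have hm0 : 0 < d * m ∨ m = 0 := by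
        rcases Nat.eq_zero_or_pos m with h | h
        · exact Or.inr h
        · exact Or.inl (Nat.mul_pos hd0 h)
      have hdm : (d * m).gcd M = d := by
        rw [Nat.Coprime.gcd_mul_right_cancel _ hm, Nat.gcd_eq_left hd]
      have hcop : d.Coprime m := (Nat.Coprime.coprime_dvd_right hd hm).symm
      rw [if_pos hdm, if_pos hm, gcd_mul_eq_of_dvd hm,
        isMultiplicative_moebius.map_mul_of_coprime hcop]
      rcases hm0 with hm0 | rfl
      · have hk := kap_eq hm0 ht
        rw [kap_mul hcop] at hk
        have hp : (psi t : ℚ) ≠ 0 := by exact_mod_cast (psi_pos ht).ne'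
        have hk' : (kap d t * kap m t / psi t : ℚ) = 1 / psi (d * m * t) := by
          rw [hk]; field_simp
        have hk'' : (kap d t * kap m t / psi t : ℝ) = 1 / psi (d * m * t) := by
          have := congrArg (Rat.cast : ℚ → ℝ) hk'
          push_cast at this
          exact this
        push_cast
        rw [div_eq_mul_one_div _ (psi (d * m * t) : ℝ), ← hk'']
        ring
      · simp
    -- A prime dividing both `m` and `M` divides `gcd (d m) M = d` too, so its square divides `d m`
    -- and `μ` vanishes.
    · rw [if_neg hm]
      simp only [Rat.cast_zero, mul_zero, ite_eq_right_iff]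
      intro hdm
      obtain ⟨p, hp, hpm, hpM⟩ := Nat.Prime.not_coprime_iff_dvd.1 hm
      have : ¬ Squarefree (d * m) := by
        intro hsq
        have hcop := (Nat.squarefree_mul_iff.1 hsq).1
        have hpd : ¬ p ∣ d := fun hpd => Nat.not_coprime_of_dvd_of_dvd hp.one_lt hpd hpm hcop
        apply hpd
        rw [← hdm]
        exact Nat.dvd_gcd (hpm.mul_left d) hpM
      rw [moebius_eq_zero_of_not_squarefree this]
      simp
  · intro n hn
    rw [if_neg]
    rintro rfl
    exact hn ⟨n / n.gcd M, Nat.mul_div_cancel' (Nat.gcd_dvd_left n M)⟩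

theorem hasSum_moebius {M t : ℕ} (hM : 0 < M) (ht : 0 < t) (c : ℕ → ℚ) :
    HasSum (fun n : ℕ => (moebius n : ℝ) * (c ((n * t).gcd M) / psi (n * t)))
      (artinConstant * ((∑ d ∈ M.divisors, moebius d * c ((d * t).gcd M) * kap d t) / psi t *
        ∏ p ∈ (M * t).primeFactors, localRatio M p : ℚ)) := by
  have h := hasSum_sum fun d (hd : d ∈ M.divisors) =>
    hasSum_fiber hM ht (Nat.dvd_of_mem_divisors hd) c
  convert h using 1
  · funext n
    rw [sum_ite_eq, if_pos (Nat.mem_divisors.2 ⟨Nat.gcd_dvd_right n M, hM.ne'⟩)]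
  · rw [← sum_mul, tsum_coprimeTerm M t hM ht]
    push_cast
    rw [sum_div]
    ring

/-- The local factor at `p` in the definition of `F H t`. -/
def localF (H t p : ℕ) : ℚ :=
  (1 - ((p * t).gcd H : ℚ) / ((p : ℚ) ^ 2 * (t.gcd H : ℚ))) *
    (1 - (p.gcd H : ℚ) / ((p : ℚ) * ((p : ℚ) - 1)))⁻¹

/-- Allows division by these factors in the definition of `G`. At `p = 2` with `H` even, `1 - (p, H)
/ (p (p - 1))` is zero. -/
theorem localF_ne_zero {H t p : ℕ} (hH : 0 < H) (hp : p.Prime) (h2 : 2 < p) :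
    localF H t p ≠ 0 := by
  have hp3 : (3 : ℚ) ≤ p := by exact_mod_cast h2
  have hg : (0 : ℚ) < t.gcd H := by exact_mod_cast Nat.gcd_pos_of_pos_right _ hH
  have h1 : ((p * t).gcd H : ℚ) ≤ p * t.gcd H := by
    have : (p * t).gcd H ∣ p * t.gcd H := by
      rw [← Nat.gcd_mul_left]
      exact Nat.dvd_gcd (Nat.gcd_dvd_left _ _) ((Nat.gcd_dvd_right _ _).mul_left p)
    exact_mod_cast Nat.le_of_dvd (Nat.mul_pos hp.pos (Nat.gcd_pos_of_pos_right _ hH)) this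
  have h3 : (p.gcd H : ℚ) ≤ p := by exact_mod_cast Nat.gcd_le_left _ hp.pos
  refine mul_ne_zero (ne_of_gt ?_) (inv_ne_zero (ne_of_gt ?_))
  · rw [sub_pos, div_lt_one (by positivity)]
    nlinarith [mul_pos (show (0:ℚ) < p by linarith) hg]
  · rw [sub_pos, div_lt_one (by nlinarith)]
    nlinarith

theorem localF_of_not_dvd {H t p : ℕ} (hH : 0 < H) (hp : p.Prime) (h : ¬ p ∣ H) :
    localF H t p = (1 - 1 / (p : ℚ) ^ 2) * (artinFactor p)⁻¹ := by
  have h1 : p.Coprime H := hp.coprime_iff_not_dvd.2 h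
  have hg : (t.gcd H : ℚ) ≠ 0 := by exact_mod_cast (Nat.gcd_pos_of_pos_right _ hH).ne'
  have hp0 : (p : ℚ) ≠ 0 := by exact_mod_cast hp.ne_zero
  unfold localF artinFactor
  rw [Nat.Coprime.gcd_mul_left_cancel _ h1, h1.gcd_eq_one]
  congr 2
  field_simp

theorem F_eq_prod_localF (H t : ℕ) : F H t =
    ((t.gcd H : ℚ) / psi t * ∏ p ∈ t.primeFactors with 2 < p, localF H t p : ℚ) := by
  simp [F, localF, psi]

theorem prod_localF_add {H t M : ℕ} (hHM : H ∣ M) :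
    ∏ p ∈ M.primeFactors with p ∣ t + M ∧ 2 < p, localF H (t + M) p =
      ∏ p ∈ M.primeFactors with p ∣ t ∧ 2 < p, localF H t p := by
  have hg : ∀ p, (p * (t + M)).gcd H = (p * t).gcd H := by
    intro p
    obtain ⟨k, rfl⟩ := hHM
    rw [mul_add, mul_left_comm, Nat.gcd_add_mul_left_left]
  have hg' : (t + M).gcd H = t.gcd H := by simpa using hg 1
  refine prod_congr (filter_congr fun p hp => ?_) fun p _ => ?_
  · rw [← Nat.dvd_add_iff_left (Nat.dvd_of_mem_primeFactors hp)]
  · simp only [localF, hg, hg']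

/-- A Möbius sum whose terms are, up to a function of `gcd (n t) M`, those for a maximal Kummer
extension, is a product of the Artin constant, `F H` and a periodic function. -/
theorem exists_periodic_moebius_sum {M H : ℕ} (hM : 0 < M) (hH : 0 < H) (hHM : H ∣ M)
    (h2 : 2 ∣ M) (c : ℕ → ℚ) :
    ∃ G : ℕ → ℚ, Function.Periodic G M ∧ ∀ t : ℕ, 0 < t →
      HasSum (fun n : ℕ => (moebius n : ℝ) * (c ((n * t).gcd M) / psi (n * t)))
        (artinConstant * F H t * (G t : ℝ)) := by
  -- The value from `hasSum_moebius` divided by `A * F H t`: `psi t` and the factors at `p ∤ M`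
  -- cancel. What remains sees `t` only through divisibility by primes of `M` and gcds with divisors
  -- of `M`, or of multiples of `t` with such divisors.
  refine ⟨fun t => (∑ d ∈ M.divisors, moebius d * c ((d * t).gcd M) * kap d t) *
    (∏ p ∈ M.primeFactors, (artinFactor p)⁻¹) /
    ((t.gcd H : ℚ) * ∏ p ∈ M.primeFactors with p ∣ t ∧ 2 < p, localF H t p), ?_, ?_⟩
  · intro t
    have hg : (t + M).gcd H = t.gcd H := by
      obtain ⟨k, rfl⟩ := hHM
      rw [Nat.gcd_add_mul_left_left]
    simp only [prod_localF_add hHM, hg]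
    congr 2
    refine sum_congr rfl fun d hd => ?_
    obtain ⟨k, hk⟩ := Nat.dvd_of_mem_divisors hd
    have h1 : (d * (t + M)).gcd M = (d * t).gcd M := by
      rw [mul_add, Nat.gcd_add_mul_right_left]
    have h3 : d.gcd (t + M) = d.gcd t := by
      rw [hk, Nat.gcd_add_mul_left_right]
    rw [h1, kap, kap, h3]
  · intro t ht
    convert hasSum_moebius hM ht c using 1
    rw [mul_assoc, F_eq_prod_localF]
    congr 1
    rw [← Rat.cast_mul]
    congr 1
    have hpsi : (psi t : ℚ) ≠ 0 := by exact_mod_cast (psi_pos ht).ne'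
    have hg : (t.gcd H : ℚ) ≠ 0 := by exact_mod_cast (Nat.gcd_pos_of_pos_right _ hH).ne'
    have hP : ∏ p ∈ M.primeFactors with p ∣ t ∧ 2 < p, localF H t p ≠ 0 :=
      prod_ne_zero_iff.2 fun p hp => by
        simp only [mem_filter] at hp
        exact localF_ne_zero hH (Nat.prime_of_mem_primeFactors hp.1) hp.2.2
    have hsplit : ∏ p ∈ t.primeFactors with 2 < p, localF H t p =
        (∏ p ∈ M.primeFactors with p ∣ t ∧ 2 < p, localF H t p) *
          ∏ p ∈ t.primeFactors with ¬ p ∣ M, localRatio M p := by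
      rw [← prod_filter_mul_prod_filter_not (t.primeFactors.filter fun p => 2 < p) (· ∣ M)]
      congr 1
      · refine prod_congr ?_ fun _ _ => rfl
        ext p
        simp only [mem_filter, Nat.mem_primeFactors]
        have := hM.ne'
        have := ht.ne'
        tauto
      -- As `M` is even, `p ∤ M` already forces `p > 2`.
      · have : ((t.primeFactors.filter fun p => 2 < p).filter fun p => ¬ p ∣ M) =
            t.primeFactors.filter fun p => ¬ p ∣ M := by
          ext p
          simp only [mem_filter, Nat.mem_primeFactors]
          refine ⟨fun h => ⟨h.1.1, h.2⟩, fun h => ⟨⟨h.1, ?_⟩, h.2⟩⟩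
          refine lt_of_le_of_ne h.1.1.two_le ?_
          rintro rfl
          exact h.2 h2
        rw [this]
        refine prod_congr rfl fun p hp => ?_
        simp only [mem_filter] at hp
        rw [localF_of_not_dvd hH (Nat.prime_of_mem_primeFactors hp.1)
          fun h => hp.2 (h.trans hHM), localRatio, if_neg hp.2]
    have hsplit' : ∏ p ∈ (M * t).primeFactors, localRatio M p =
        (∏ p ∈ M.primeFactors, (artinFactor p)⁻¹) *
          ∏ p ∈ t.primeFactors with ¬ p ∣ M, localRatio M p := by
      rw [← prod_filter_mul_prod_filter_not (M * t).primeFactors (· ∣ M)]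
      congr 1
      · refine prod_congr ?_ fun p hp => ?_
        · rw [Nat.primeFactors_mul hM.ne' ht.ne']
          ext p
          simp only [mem_filter, mem_union, Nat.mem_primeFactors]
          have := hM.ne'
          tauto
        · rw [localRatio, if_pos (Nat.dvd_of_mem_primeFactors hp)]
      · refine prod_congr ?_ fun _ _ => rfl
        rw [Nat.primeFactors_mul hM.ne' ht.ne']
        ext p
        simp only [mem_filter, mem_union, Nat.mem_primeFactors]
        tauto
    rw [hsplit, hsplit']
    field_simp

/-- For `p ∣ m` and `n` coprime to `m`, both `(p m n, H)` and `(m n, H)` contain the factor `(n,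
H)`, which cancels in the local factor. -/
theorem F_isMultiplicative {H : ℕ} (hH : 0 < H) : (F H).IsMultiplicative := by
  have key : ∀ {m n p : ℕ}, m.Coprime n → p.Prime → p ∣ m → localF H (m * n) p = localF H m p := by
    intro m n p hmn hp hpm
    have hpn : p.Coprime n := hmn.coprime_dvd_left hpm
    have hn : (n.gcd H : ℚ) ≠ 0 := by exact_mod_cast (Nat.gcd_pos_of_pos_right _ hH).ne'
    have hm : (m.gcd H : ℚ) ≠ 0 := by exact_mod_cast (Nat.gcd_pos_of_pos_right _ hH).ne'
    have hp0 : (p : ℚ) ≠ 0 := by exact_mod_cast hp.ne_zero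
    unfold localF
    rw [← mul_assoc, Nat.Coprime.mul_gcd (Nat.Coprime.mul_left hpn hmn), Nat.Coprime.mul_gcd hmn]
    push_cast
    congr 2
    field_simp
  rw [IsMultiplicative.iff_ne_zero]
  refine ⟨by simp [F], fun {m n} hm hn hmn => ?_⟩
  rw [F_eq_prod_localF, F_eq_prod_localF, F_eq_prod_localF, ← Rat.cast_mul]
  congr 1
  have hpsi : psi (m * n) = psi m * psi n := by
    unfold psi; rw [Nat.totient_mul hmn]; ring
  rw [hpsi, Nat.Coprime.mul_gcd hmn, hmn.primeFactors_mul, filter_union,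
    prod_union (disjoint_filter_filter hmn.disjoint_primeFactors)]
  have e1 : ∏ p ∈ m.primeFactors with 2 < p, localF H (m * n) p =
      ∏ p ∈ m.primeFactors with 2 < p, localF H m p := by
    refine prod_congr rfl fun p hp => ?_
    simp only [mem_filter, Nat.mem_primeFactors] at hp
    exact key hmn hp.1.1 hp.1.2.1
  have e2 : ∏ p ∈ n.primeFactors with 2 < p, localF H (m * n) p =
      ∏ p ∈ n.primeFactors with 2 < p, localF H n p := by
    refine prod_congr rfl fun p hp => ?_
    simp only [mem_filter, Nat.mem_primeFactors] at hp
    rw [mul_comm]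
    exact key hmn.symm hp.1.1 hp.1.2.1
  rw [e1, e2]
  push_cast
  rw [mul_div_mul_comm]
  ring

end LucasIndex

/-! ### Growth of power sums `x ^ k + y ^ k` with `x y = 1` -/

namespace LucasIndex

/-- The numerators (over the denominators `b ^ k`) of the power sums `x ^ k + y ^ k` when
`x * y = 1` and `x + y = a / b`. -/
def powerSumNum (a b : ℤ) : ℕ → ℤ
  | 0 => 2
  | 1 => a
  | k + 2 => a * powerSumNum a b (k + 1) - b ^ 2 * powerSumNum a b k

theorem powerSumNum_eq {x y : ℂ} {a b : ℤ} (hb : (b : ℂ) ≠ 0) (hxy : x * y = 1)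
    (hT : x + y = a / b) (k : ℕ) : (powerSumNum a b k : ℂ) = b ^ k * (x ^ k + y ^ k) := by
  have ha : (a : ℂ) = b * (x + y) := by rw [hT]; field_simp
  induction k using Nat.twoStepInduction with
  | zero => norm_num [powerSumNum]
  | one => simp [powerSumNum, ha]
  | more k ih1 ih2 =>
    simp only [powerSumNum]
    push_cast
    rw [ih1, ih2, ha]
    linear_combination (b : ℂ) ^ (k + 2) * (x ^ k + y ^ k) * hxy

/-- When `a` and `b` are coprime, the numerators thus stay prime to `b`, and no cancellation occurs
against the denominator `b ^ (k + 1)`. -/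
theorem powerSumNum_modEq (a b : ℤ) (k : ℕ) :
    powerSumNum a b (k + 1) ≡ a ^ (k + 1) [ZMOD b] := by
  induction k with
  | zero => simp [powerSumNum]
  | succ k ih =>
    simp only [powerSumNum]
    rw [pow_succ' a]
    have h : b ^ 2 * powerSumNum a b k ≡ 0 [ZMOD b] :=
      (Int.modEq_zero_iff_dvd).2 ((dvd_pow_self b two_ne_zero).mul_right _)
    simpa using (ih.mul_left a).sub h

theorem two_pow_le_abs_powerSumNum {a : ℤ} (ha : 3 ≤ |a|) (k : ℕ) :
    2 ^ k ≤ |powerSumNum a 1 k| ∧ |powerSumNum a 1 k| ≤ |powerSumNum a 1 (k + 1)| ∧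
      2 ^ (k + 1) ≤ |powerSumNum a 1 (k + 1)| := by
  induction k with
  | zero => simp [powerSumNum]; omega
  | succ k ih =>
    obtain ⟨h1, h2, h3⟩ := ih
    have h4 : |a| * |powerSumNum a 1 (k + 1)| - |powerSumNum a 1 k| ≤
        |powerSumNum a 1 (k + 2)| := by
      rw [← abs_mul]
      simpa [powerSumNum] using
        abs_sub_abs_le_abs_sub (a * powerSumNum a 1 (k + 1)) (powerSumNum a 1 k)
    have h5 := abs_nonneg (powerSumNum a 1 (k + 1))
    have h6 : 2 * |powerSumNum a 1 (k + 1)| ≤ |powerSumNum a 1 (k + 2)| := by nlinarith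
    refine ⟨h3, by linarith, ?_⟩
    rw [pow_succ]
    linarith

/-- If `x` is not a root of unity, `x y = 1` and `x + y` is rational, then the exponent `d` is
bounded in terms of the rational number `x ^ d + y ^ d`. -/
theorem le_of_powerSum_eq {x y : ℂ} {T τ : ℚ} (hxy : x * y = 1) (hT : x + y = T)
    (hx : ∀ n : ℕ, 0 < n → x ^ n ≠ 1) {d : ℕ} (hd : 0 < d) (hτ : x ^ d + y ^ d = τ) :
    d ≤ τ.den + τ.num.natAbs := by
  have hb : ((T.den : ℤ) : ℂ) ≠ 0 := by exact_mod_cast T.den_nz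
  have hT' : x + y = T.num / (T.den : ℤ) := by
    rw [hT]
    push_cast
    exact Rat.cast_def T
  have h := powerSumNum_eq hb hxy hT' d
  rw [hτ, Rat.cast_def] at h
  have hτd : ((τ.den : ℤ) : ℂ) ≠ 0 := by exact_mod_cast τ.den_nz
  have h' : powerSumNum T.num T.den d * τ.den = (T.den : ℤ) ^ d * τ.num := by
    have : (powerSumNum T.num T.den d * τ.den : ℂ) = (T.den : ℂ) ^ d * τ.num := by
      rw [h]
      push_cast at hτd ⊢
      field_simp
    exact_mod_cast this
  -- If `T` is an integer, the power sums themselves grow exponentially; otherwise their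
  -- denominators do.
  rcases Nat.lt_or_ge T.den 2 with h2 | h2
  · have h1 : T.den = 1 := by have := T.den_pos; omega
    rw [h1] at h' hT'
    have ha : 3 ≤ |T.num| := by
      -- For an integer `|T| ≤ 2` the roots of `X² - T X + 1` are roots of unity of order 1, 2, 3, 4
      -- or 6, all dividing 12.
      by_contra! hlt
      have hlt' := abs_lt.1 hlt
      have hyx : x ^ 2 = T.num * x - 1 := by
        have : (T.num : ℂ) = x + y := by rw [hT']; simp
        rw [this]
        linear_combination -hxy
      have h12 : x ^ 12 = 1 := by
        generalize T.num = a at hlt' hyx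
        obtain ⟨h3, h4⟩ := hlt'
        interval_cases a <;> push_cast at hyx
        · have : x = -1 := by
            have : (x + 1) ^ 2 = 0 := by linear_combination hyx
            have := pow_eq_zero_iff (two_ne_zero) |>.1 this
            linear_combination this
          rw [this]; norm_num
        · have : x ^ 3 = 1 := by linear_combination (x - 1) * hyx
          linear_combination (x ^ 9 + x ^ 6 + x ^ 3 + 1) * this
        · have : x ^ 4 = 1 := by linear_combination (x ^ 2 - 1) * hyx
          linear_combination (x ^ 8 + x ^ 4 + 1) * this
        · have : x ^ 3 = -1 := by linear_combination (x + 1) * hyx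
          linear_combination (x ^ 9 - x ^ 6 + x ^ 3 - 1) * this
        · have : x = 1 := by
            have : (x - 1) ^ 2 = 0 := by linear_combination hyx
            have := pow_eq_zero_iff (two_ne_zero) |>.1 this
            linear_combination this
          rw [this]; norm_num
      exact hx 12 (by norm_num) h12
    have h3 := (two_pow_le_abs_powerSumNum ha d).1
    have h4 : τ.num = powerSumNum T.num 1 d * τ.den := by simpa using h'.symm
    have h5 : (d : ℤ) < 2 ^ d := by exact_mod_cast Nat.lt_two_pow_self
    have h6 : |powerSumNum T.num 1 d| ≤ |τ.num| := by
      rw [h4, abs_mul]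
      refine le_mul_of_one_le_right (abs_nonneg _) ?_
      have := τ.den_pos
      rw [abs_of_nonneg (by positivity)]
      exact_mod_cast this
    have h7 : (d : ℤ) ≤ |τ.num| := by linarith
    rw [Int.abs_eq_natAbs] at h7
    omega
  · obtain ⟨k, rfl⟩ : ∃ k, d = k + 1 := ⟨d - 1, by omega⟩
    have hcop : IsCoprime (powerSumNum T.num T.den (k + 1)) (T.den : ℤ) := by
      have h0 : IsCoprime (T.num ^ (k + 1)) (T.den : ℤ) :=
        (Rat.isCoprime_num_den T).pow_left
      obtain ⟨c, hc⟩ := (powerSumNum_modEq T.num T.den k).symm.dvd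
      have : powerSumNum T.num T.den (k + 1) = T.num ^ (k + 1) + T.den * c := by linarith
      rw [this]
      exact h0.add_mul_left_left c
    have hdvd : (T.den : ℤ) ^ (k + 1) ∣ τ.den :=
      (hcop.symm.pow_left).dvd_of_dvd_mul_left ⟨τ.num, h'⟩
    have hdvd' : T.den ^ (k + 1) ∣ τ.den := by exact_mod_cast hdvd
    have h3 := Nat.le_of_dvd τ.den_pos hdvd'
    have h4 : 2 ^ (k + 1) ≤ T.den ^ (k + 1) := Nat.pow_le_pow_left h2 _
    have h5 : k + 1 < 2 ^ (k + 1) := Nat.lt_two_pow_self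
    omega

end LucasIndex

/-! ### The quadratic field `K` and the exponents of powers in it -/

namespace LucasIndex

open IntermediateField Polynomial

variable {a₁ a₂ : ℤ}

theorem α_mul_β (a₁ a₂ : ℤ) : α a₁ a₂ * β a₁ a₂ = -a₂ := by
  have h := sqrtD_sq a₁ a₂
  unfold α β D at *
  push_cast at h
  linear_combination -h / 4

theorem β_ne_zero (h2 : a₂ ≠ 0) : β a₁ a₂ ≠ 0 := by
  intro h
  have := α_mul_β a₁ a₂
  rw [h, mul_zero] at this
  exact h2 (by exact_mod_cast neg_eq_zero.1 this.symm)

theorem α_ne_zero (h2 : a₂ ≠ 0) : α a₁ a₂ ≠ 0 := by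
  intro h
  have := α_mul_β a₁ a₂
  rw [h, zero_mul] at this
  exact h2 (by exact_mod_cast neg_eq_zero.1 this.symm)

theorem γ_ne_zero (h2 : a₂ ≠ 0) : γ a₁ a₂ ≠ 0 :=
  div_ne_zero (α_ne_zero h2) (β_ne_zero h2)

theorem γ_mul_eq (h2 : a₂ ≠ 0) :
    γ a₁ a₂ * (a₁ - sqrtD a₁ a₂) = a₁ + sqrtD a₁ a₂ := by
  have h := div_mul_cancel₀ (α a₁ a₂) (β_ne_zero (a₁ := a₁) h2)
  change γ a₁ a₂ * β a₁ a₂ = α a₁ a₂ at h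
  unfold α β at h
  linear_combination 2 * h

/-- From `γ = α² / (α β) = -α² / a₂` and `4 α² = a₁² + D + 2 a₁ √D`. It shows that `γ` generates
`K`, so an embedding is determined by its value at `γ`. -/
theorem sqrtD_eq (h1 : a₁ ≠ 0) (h2 : a₂ ≠ 0) :
    sqrtD a₁ a₂ = (-4 * a₂ * γ a₁ a₂ - a₁ ^ 2 - D a₁ a₂) / (2 * a₁) := by
  have ha : (a₁ : ℂ) ≠ 0 := by exact_mod_cast h1
  have h := γ_mul_eq (a₁ := a₁) h2
  have hs := sqrtD_sq a₁ a₂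
  rw [eq_div_iff (mul_ne_zero two_ne_zero ha)]
  have hD : (D a₁ a₂ : ℂ) = a₁ ^ 2 + 4 * a₂ := by simp [D]
  rw [hD] at hs ⊢
  linear_combination (-(a₁ + sqrtD a₁ a₂)) * h + (-(1 + γ a₁ a₂)) * hs

theorem γ_mem {E : IntermediateField ℚ ℂ} (hs : sqrtD a₁ a₂ ∈ E) : γ a₁ a₂ ∈ E := by
  unfold γ α β
  have h1 : (a₁ : ℂ) ∈ E := by simp
  have h2 : (2 : ℂ) ∈ E := by simp
  exact div_mem (div_mem (add_mem h1 hs) h2) (div_mem (sub_mem h1 hs) h2)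

theorem map_sqrtD {E : IntermediateField ℚ ℂ} (φ : E →ₐ[ℚ] ℂ) {s : E}
    (hs : (s : ℂ) = sqrtD a₁ a₂) : φ s = sqrtD a₁ a₂ ∨ φ s = -sqrtD a₁ a₂ := by
  rw [← sq_eq_sq_iff_eq_or_eq_neg, ← map_pow, sqrtD_sq]
  have : s ^ 2 = ((D a₁ a₂ : ℤ) : E) := Subtype.ext (by push_cast; rw [hs, sqrtD_sq])
  rw [this, map_intCast]

theorem map_γ_aux {E : IntermediateField ℚ ℂ} (h2 : a₂ ≠ 0) (φ : E →ₐ[ℚ] ℂ) {s g : E}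
    (hs : (s : ℂ) = sqrtD a₁ a₂) (hg : (g : ℂ) = γ a₁ a₂) :
    φ g * (a₁ - φ s) = a₁ + φ s := by
  have h : g * ((a₁ : ℤ) - s) = (a₁ : ℤ) + s :=
    Subtype.ext (by push_cast; rw [hs, hg, γ_mul_eq h2])
  have := congrArg φ h
  simpa using this

theorem map_γ_of_eq {E : IntermediateField ℚ ℂ} (h2 : a₂ ≠ 0) (φ : E →ₐ[ℚ] ℂ) {s g : E}
    (hs : (s : ℂ) = sqrtD a₁ a₂) (hg : (g : ℂ) = γ a₁ a₂) (h : φ s = sqrtD a₁ a₂) :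
    φ g = γ a₁ a₂ := by
  have h' := map_γ_aux h2 φ hs hg
  rw [h, ← γ_mul_eq h2] at h'
  have hβ := β_ne_zero (a₁ := a₁) h2
  refine mul_right_cancel₀ (fun h0 => hβ ?_) h'
  rw [β, h0, zero_div]

theorem map_γ_of_eq_neg {E : IntermediateField ℚ ℂ} (h2 : a₂ ≠ 0) (φ : E →ₐ[ℚ] ℂ) {s g : E}
    (hs : (s : ℂ) = sqrtD a₁ a₂) (hg : (g : ℂ) = γ a₁ a₂) (h : φ s = -sqrtD a₁ a₂) :
    φ g = (γ a₁ a₂)⁻¹ := by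
  have h' := map_γ_aux h2 φ hs hg
  have h'' := γ_mul_eq (a₁ := a₁) h2
  rw [h] at h'
  refine (inv_eq_of_mul_eq_one_right ?_).symm
  have hα := α_ne_zero (a₁ := a₁) h2
  have h0 : (a₁ + sqrtD a₁ a₂ : ℂ) ≠ 0 := fun h0 => hα (by rw [α, h0, zero_div])
  refine mul_right_cancel₀ h0 ?_
  linear_combination γ a₁ a₂ * h' + h''

theorem map_γ {E : IntermediateField ℚ ℂ} (h2 : a₂ ≠ 0) (φ : E →ₐ[ℚ] ℂ) {s g : E}
    (hs : (s : ℂ) = sqrtD a₁ a₂) (hg : (g : ℂ) = γ a₁ a₂) :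
    φ g = γ a₁ a₂ ∨ φ g = (γ a₁ a₂)⁻¹ :=
  (map_sqrtD φ hs).imp (map_γ_of_eq h2 φ hs hg) (map_γ_of_eq_neg h2 φ hs hg)

theorem not_isSquare_rat (hD : ¬ IsSquare (D a₁ a₂)) (b : ℚ) : b ^ 2 ≠ D a₁ a₂ := by
  intro h
  exact hD (Rat.isSquare_intCast_iff.1 ⟨b, by rw [← h, sq]⟩)

theorem minpoly_sqrtD (hD : ¬ IsSquare (D a₁ a₂)) :
    minpoly ℚ (sqrtD a₁ a₂) = X ^ 2 - C (D a₁ a₂ : ℚ) := by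
  symm
  refine minpoly.eq_of_irreducible_of_monic
    ((X_pow_sub_C_irreducible_iff_of_prime Nat.prime_two).2 (not_isSquare_rat hD)) ?_
    (monic_X_pow_sub_C _ two_ne_zero)
  simp [sqrtD_sq]

theorem exists_conj (hD : ¬ IsSquare (D a₁ a₂)) :
    ∃ φ : K a₁ a₂ →ₐ[ℚ] ℂ, ∀ s : K a₁ a₂, (s : ℂ) = sqrtD a₁ a₂ → φ s = -sqrtD a₁ a₂ := by
  have hroot : -sqrtD a₁ a₂ ∈ (minpoly ℚ (sqrtD a₁ a₂)).aroots ℂ := by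
    rw [mem_aroots]
    refine ⟨minpoly.ne_zero (isIntegral_sqrtD a₁ a₂), ?_⟩
    rw [minpoly_sqrtD hD]
    simp [sqrtD_sq]
  refine ⟨(algHomAdjoinIntegralEquiv ℚ (isIntegral_sqrtD a₁ a₂)).symm ⟨_, hroot⟩, ?_⟩
  intro s hs
  have : s = AdjoinSimple.gen ℚ (sqrtD a₁ a₂) := Subtype.ext hs
  rw [this]
  exact algHomAdjoinIntegralEquiv_symm_apply_gen ℚ (isIntegral_sqrtD a₁ a₂) ⟨_, hroot⟩

theorem exists_rat_of_mem_K (hD : ¬ IsSquare (D a₁ a₂)) {c : ℂ} (hc : c ∈ K a₁ a₂) :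
    ∃ p q : ℚ, c = p + q * sqrtD a₁ a₂ := by
  have hs := sqrtD_sq a₁ a₂
  induction hc using adjoin_induction with
  | mem x hx => exact ⟨0, 1, by simpa using hx⟩
  | algebraMap x => exact ⟨x, 0, by simp⟩
  | add x y _ _ hx hy =>
    obtain ⟨p, q, rfl⟩ := hx
    obtain ⟨p', q', rfl⟩ := hy
    exact ⟨p + p', q + q', by push_cast; ring⟩
  | mul x y _ _ hx hy =>
    obtain ⟨p, q, rfl⟩ := hx
    obtain ⟨p', q', rfl⟩ := hy
    refine ⟨p * p' + q * q' * D a₁ a₂, p * q' + q * p', ?_⟩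
    push_cast
    linear_combination (q * q' : ℂ) * hs
  | inv x _ hx =>
    obtain ⟨p, q, rfl⟩ := hx
    by_cases hN : p ^ 2 - q ^ 2 * D a₁ a₂ = 0
    · by_cases hq : q = 0
      · exact ⟨p⁻¹, 0, by simp [hq]⟩
      · exact absurd (by field_simp; linear_combination hN) (not_isSquare_rat hD (p / q))
    · refine ⟨p / (p ^ 2 - q ^ 2 * D a₁ a₂), -q / (p ^ 2 - q ^ 2 * D a₁ a₂), ?_⟩
      have hN' : (p : ℂ) ^ 2 - q ^ 2 * D a₁ a₂ ≠ 0 := by exact_mod_cast hN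
      refine inv_eq_of_mul_eq_one_right ?_
      push_cast
      field_simp
      linear_combination (-(q : ℂ) ^ 2) * hs

/-- Only boundedly many exponents `d` are such that `γ ^ 24` is a `d`-th power in `K`. -/
theorem exists_bound_pow_eq (h2 : a₂ ≠ 0) (hD : ¬ IsSquare (D a₁ a₂))
    (hnd : Nondegenerate a₁ a₂) :
    ∃ B : ℕ, ∀ d : ℕ, 0 < d → ∀ c ∈ K a₁ a₂, c ^ d = γ a₁ a₂ ^ 24 → d ≤ B := by
  have hsK : sqrtD a₁ a₂ ∈ K a₁ a₂ := subset_adjoin _ _ rfl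
  obtain ⟨φ, hφ⟩ := exists_conj hD
  have hφs : φ ⟨_, hsK⟩ = -sqrtD a₁ a₂ := hφ ⟨_, hsK⟩ rfl
  have hs := sqrtD_sq a₁ a₂
  have hconj : ∀ (p q : ℚ) (hc : (p + q * sqrtD a₁ a₂ : ℂ) ∈ K a₁ a₂),
      φ ⟨_, hc⟩ = p - q * sqrtD a₁ a₂ := by
    intro p q hc
    have : (⟨_, hc⟩ : K a₁ a₂) = (p : K a₁ a₂) + (q : K a₁ a₂) * ⟨_, hsK⟩ :=
      Subtype.ext (by push_cast; rfl)
    rw [this, map_add, map_mul, hφs, map_ratCast, map_ratCast]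
    ring
  have hγK := γ_mem hsK
  have hφγ : φ ⟨_, hγK⟩ = (γ a₁ a₂)⁻¹ := map_γ_of_eq_neg h2 φ (s := ⟨_, hsK⟩) rfl rfl hφs
  have hγ0 := γ_ne_zero (a₁ := a₁) h2
  -- The power-sum bound is applied to `c ^ 2`, whose `d`-th power is `γ ^ 48`, of trace `2 u`; the
  -- resulting bound does not involve `d`.
  obtain ⟨u, v, huv⟩ := exists_rat_of_mem_K hD (pow_mem hγK 48)
  have huv' : (γ a₁ a₂)⁻¹ ^ 48 = u - v * sqrtD a₁ a₂ := by
    rw [← hφγ, ← map_pow, ← hconj u v (huv ▸ pow_mem hγK 48)]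
    congr 1
    exact Subtype.ext huv
  refine ⟨(2 * u).den + (2 * u).num.natAbs, fun d hd c hc hcd => ?_⟩
  obtain ⟨p, q, hpq⟩ := exists_rat_of_mem_K hD hc
  have hcd' : (p - q * sqrtD a₁ a₂ : ℂ) ^ d = (γ a₁ a₂)⁻¹ ^ 24 := by
    rw [← hconj p q (hpq ▸ hc), ← hφγ, ← map_pow, ← map_pow]
    congr 1
    refine Subtype.ext ?_
    push_cast
    rw [← hpq, hcd]
  rw [hpq] at hcd
  set x : ℂ := p + q * sqrtD a₁ a₂
  set y : ℂ := p - q * sqrtD a₁ a₂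
  set N : ℚ := p ^ 2 - q ^ 2 * D a₁ a₂
  have hN : x * y = N := by
    simp only [x, y, N]
    push_cast
    linear_combination (-(q : ℂ) ^ 2) * hs
  have hNd : N ^ d = 1 := by
    have : (N : ℂ) ^ d = 1 := by
      rw [← hN, mul_pow, hcd, hcd', ← mul_pow, mul_inv_cancel₀ hγ0, one_pow]
    exact_mod_cast this
  -- The norm of `c` is only known to be `±1`; squaring `c` makes the product of the conjugates
  -- equal to 1.
  have hN2 : N ^ 2 = 1 := by
    have : |N| ^ d = 1 := by rw [← abs_pow, hNd, abs_one]
    rw [← sq_abs, (pow_eq_one_iff_of_nonneg (abs_nonneg N) hd.ne').1 this, one_pow]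
  refine le_of_powerSum_eq (x := x ^ 2) (y := y ^ 2) (T := (2 * p) ^ 2 - 2 * N) ?_ ?_ ?_ hd ?_
  · rw [← mul_pow, hN]
    exact_mod_cast hN2
  · push_cast
    rw [← hN]
    simp only [x, y]
    ring
  · intro n hn h
    refine hnd (48 * n) (by omega) ?_
    calc γ a₁ a₂ ^ (48 * n) = ((γ a₁ a₂ ^ 24) ^ 2) ^ n := by rw [← pow_mul, ← pow_mul]; congr 1; omega
      _ = ((x ^ 2) ^ n) ^ d := by rw [← hcd]; simp only [← pow_mul]; congr 1; ring
      _ = 1 := by rw [h, one_pow]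
  · rw [pow_right_comm x, pow_right_comm y, hcd, hcd', ← pow_mul, ← pow_mul, huv, huv']
    push_cast
    ring

end LucasIndex

/-! ### Descent of `d`-th powers from `K(ζ_n)` to `K` -/

namespace LucasIndex

open IntermediateField Polynomial

variable {a₁ a₂ : ℤ}

theorem ζ_isPrimitiveRoot {n : ℕ} (hn : 0 < n) : IsPrimitiveRoot (ζ n) n :=
  Complex.isPrimitiveRoot_exp n hn.ne'

/-- The field `K(ζ_n)`. -/
noncomputable def Ln (a₁ a₂ : ℤ) (n : ℕ) : IntermediateField ℚ ℂ := adjoin ℚ {sqrtD a₁ a₂, ζ n}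

theorem sqrtD_mem_Ln (a₁ a₂ : ℤ) (n : ℕ) : sqrtD a₁ a₂ ∈ Ln a₁ a₂ n :=
  subset_adjoin _ _ (by simp)

theorem ζ_mem_Ln (a₁ a₂ : ℤ) (n : ℕ) : ζ n ∈ Ln a₁ a₂ n :=
  subset_adjoin _ _ (by simp)

theorem mem_Ln_of_pow_eq_one {n : ℕ} (hn : 0 < n) {w : ℂ} (hw : w ^ n = 1) :
    w ∈ Ln a₁ a₂ n := by
  have := NeZero.of_pos hn
  obtain ⟨i, -, rfl⟩ := (ζ_isPrimitiveRoot hn).eq_pow_of_pow_eq_one hw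
  exact pow_mem (ζ_mem_Ln _ _ _) i

theorem Ln_isSplittingField {n : ℕ} (hn : 0 < n) :
    ((X ^ 2 - C (D a₁ a₂ : ℚ)) * (X ^ n - 1)).IsSplittingField ℚ (Ln a₁ a₂ n) := by
  have hne : ((X ^ 2 - C (D a₁ a₂ : ℚ)) * (X ^ n - 1) : ℚ[X]) ≠ 0 :=
    mul_ne_zero (monic_X_pow_sub_C _ two_ne_zero).ne_zero
      (by simpa using (monic_X_pow_sub_C (1 : ℚ) hn.ne').ne_zero)
  have : Ln a₁ a₂ n =
      adjoin ℚ (((X ^ 2 - C (D a₁ a₂ : ℚ)) * (X ^ n - 1)).rootSet ℂ) := by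
    refine le_antisymm (adjoin_le_iff.2 ?_) (adjoin_le_iff.2 ?_)
    · rintro x (rfl | rfl)
      · refine subset_adjoin _ _ ((mem_rootSet_of_ne hne).2 ?_)
        simp [sqrtD_sq]
      · refine subset_adjoin _ _ ((mem_rootSet_of_ne hne).2 ?_)
        simp [(ζ_isPrimitiveRoot hn).pow_eq_one]
    · intro x hx
      rw [mem_rootSet_of_ne hne] at hx
      rw [map_mul, mul_eq_zero] at hx
      rcases hx with hx | hx
      · have : x ^ 2 = sqrtD a₁ a₂ ^ 2 := by
          rw [sqrtD_sq]
          simpa [sub_eq_zero] using hx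
        rcases sq_eq_sq_iff_eq_or_eq_neg.1 this with rfl | rfl
        · exact sqrtD_mem_Ln _ _ _
        · exact neg_mem (sqrtD_mem_Ln _ _ _)
      · exact mem_Ln_of_pow_eq_one hn (by simpa [sub_eq_zero] using hx)
  rw [this]
  exact adjoin_rootSet_isSplittingField (IsAlgClosed.splits _)

theorem finiteDimensional_Ln {n : ℕ} (hn : 0 < n) : FiniteDimensional ℚ (Ln a₁ a₂ n) :=
  have := Ln_isSplittingField (a₁ := a₁) (a₂ := a₂) hn
  IsSplittingField.finiteDimensional _ ((X ^ 2 - C (D a₁ a₂ : ℚ)) * (X ^ n - 1))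

theorem isGalois_Ln {n : ℕ} (hn : 0 < n) : IsGalois ℚ (Ln a₁ a₂ n) :=
  have := Ln_isSplittingField (a₁ := a₁) (a₂ := a₂) hn
  have := Normal.of_isSplittingField (F := ℚ) (E := Ln a₁ a₂ n)
    ((X ^ 2 - C (D a₁ a₂ : ℚ)) * (X ^ n - 1))
  ⟨⟩

/-- An integer all of whose coprime residues have square `1` divides `24`. -/
theorem dvd_twentyfour {m : ℕ} (hm : 0 < m)
    (h : ∀ y : ℕ, y.Coprime m → (m : ℤ) ∣ (y : ℤ) ^ 2 - 1) : m ∣ 24 := by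
  -- With `q` the odd part of `m`, the residue `q + 2` gives `q ∣ 3`; then 5 is prime to `m` and `m
  -- ∣ 5² - 1`.
  obtain ⟨a, q, hq, rfl⟩ := Nat.exists_eq_two_pow_mul_odd hm.ne'
  have hq2 : Nat.Coprime 2 q := (Nat.coprime_two_left).2 hq
  have h1 : (q + 2).Coprime (2 ^ a * q) := by
    refine Nat.Coprime.mul_right (Nat.Coprime.pow_right a ?_) ?_
    · exact (Nat.coprime_two_right).2 (hq.add_even even_two)
    · simpa using hq2
  have h3 : q ∣ 3 := by
    have h := (Dvd.intro_left ((2 : ℤ) ^ a) rfl).trans (by exact_mod_cast h _ h1 :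
      ((2 : ℤ) ^ a * (q : ℤ)) ∣ ((q + 2 : ℕ) : ℤ) ^ 2 - 1)
    have h' : (q : ℤ) ∣ 3 := by
      have h'' : ((q + 2 : ℕ) : ℤ) ^ 2 - 1 = q * (q + 4) + 3 := by push_cast; ring
      rw [h''] at h
      exact (Int.dvd_add_right (Dvd.intro _ rfl)).1 h
    exact_mod_cast h'
  have h5 : Nat.Coprime 5 (2 ^ a * q) := by
    refine Nat.Coprime.mul_right (Nat.Coprime.pow_right a (by norm_num)) ?_
    exact Nat.Coprime.coprime_dvd_right h3 (by norm_num)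
  have := h 5 h5
  norm_num at this
  exact_mod_cast this

theorem exists_coprime_modEq {m n : ℕ} (hn : 0 < n) (hmn : m ∣ n) {y : ℕ} (hy : y.Coprime m) :
    ∃ x : ℕ, x.Coprime n ∧ x ≡ y [MOD m] := by
  have := NeZero.of_pos hn
  obtain ⟨u, hu⟩ := ZMod.unitsMap_surjective hmn (ZMod.unitOfCoprime y hy)
  refine ⟨(u : ZMod n).val, ZMod.val_coe_unit_coprime u, ?_⟩
  rw [← ZMod.natCast_eq_natCast_iff]
  have := congrArg (fun v : (ZMod m)ˣ => (v : ZMod m)) hu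
  simp only [ZMod.unitsMap_val, ZMod.coe_unitOfCoprime] at this
  rw [← this, ZMod.cast_eq_val]

theorem mem_K_of_fixed {n : ℕ} (hn : 0 < n) {c : Ln a₁ a₂ n}
    (h : ∀ τ : Ln a₁ a₂ n ≃ₐ[ℚ] Ln a₁ a₂ n,
      τ ⟨_, sqrtD_mem_Ln a₁ a₂ n⟩ = ⟨_, sqrtD_mem_Ln a₁ a₂ n⟩ → τ c = c) :
    (c : ℂ) ∈ K a₁ a₂ := by
  have := finiteDimensional_Ln (a₁ := a₁) (a₂ := a₂) hn
  have := isGalois_Ln (a₁ := a₁) (a₂ := a₂) hn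
  set s : Ln a₁ a₂ n := ⟨_, sqrtD_mem_Ln a₁ a₂ n⟩
  have hc : c ∈ fixedField (fixingSubgroup (ℚ⟮s⟯)) := by
    rw [mem_fixedField_iff]
    intro τ hτ
    refine h τ ?_
    exact (IntermediateField.mem_fixingSubgroup_iff _ _).1 hτ s (mem_adjoin_simple_self ℚ s)
  rw [IsGalois.fixedField_fixingSubgroup] at hc
  clear h
  induction hc using adjoin_induction with
  | mem x hx =>
    obtain rfl := hx
    exact subset_adjoin _ _ rfl
  | algebraMap x => simp
  | add x y _ _ hx hy => exact add_mem hx hy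
  | mul x y _ _ hx hy => exact mul_mem hx hy
  | inv x _ hx => exact inv_mem hx

/-- For `b ∈ K(ζ_n)` with `b ^ d = γ` and `x` coprime to `n`, the power `γ ^ (x² - 1)` is a
`d`-th power in `K`. -/
theorem exists_pow_eq_of_coprime (h2 : a₂ ≠ 0) {n d : ℕ} (hn : 0 < n) (hdn : d ∣ n) {b : ℂ}
    (hb : b ∈ Ln a₁ a₂ n) (hbd : b ^ d = γ a₁ a₂) {x : ℕ} (hx : x.Coprime n) :
    ∃ c ∈ K a₁ a₂, c ^ d = γ a₁ a₂ ^ ((x : ℤ) ^ 2 - 1) := by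
  have := NeZero.of_pos hn
  have := isGalois_Ln (a₁ := a₁) (a₂ := a₂) hn
  have hγ0 := γ_ne_zero (a₁ := a₁) h2
  set L := Ln a₁ a₂ n
  let s : L := ⟨_, sqrtD_mem_Ln a₁ a₂ n⟩
  let z : L := ⟨_, ζ_mem_Ln a₁ a₂ n⟩
  let g : L := ⟨_, γ_mem (sqrtD_mem_Ln a₁ a₂ n)⟩
  let b' : L := ⟨b, hb⟩
  have hb' : b' ^ d = g := Subtype.ext hbd
  have hg0 : g ≠ 0 := fun h => hγ0 (congrArg Subtype.val h)
  have hb0 : b' ≠ 0 := by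
    intro h
    rw [h] at hb'
    rcases Nat.eq_zero_or_pos d with rfl | hd
    · exact hn.ne' (Nat.eq_zero_of_zero_dvd hdn)
    · exact hg0 (by rw [← hb', zero_pow hd.ne'])
  have hz : IsPrimitiveRoot z n :=
    IsPrimitiveRoot.of_map_of_injective (f := L.val) (ζ_isPrimitiveRoot hn) L.val.injective
  obtain ⟨σ, hσ⟩ : ∃ σ : L ≃ₐ[ℚ] L, σ z = z ^ x := by
    refine minpoly.exists_algEquiv_of_root' (Algebra.IsAlgebraic.isAlgebraic z) ?_
    rw [← cyclotomic_eq_minpoly_rat hz hn,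
      cyclotomic_eq_minpoly_rat (hz.pow_of_coprime x hx) hn]
    exact minpoly.aeval _ _
  have hsgn : ∀ τ : L ≃ₐ[ℚ] L, τ s = s ∨ τ s = -s := by
    intro τ
    rcases map_sqrtD (L.val.comp τ.toAlgHom) (s := s) rfl with h | h
    · exact Or.inl (Subtype.ext h)
    · exact Or.inr (Subtype.ext h)
  have hfixg : ∀ τ : L ≃ₐ[ℚ] L, τ s = s → τ g = g := fun τ h =>
    Subtype.ext (map_γ_of_eq h2 (L.val.comp τ.toAlgHom) (s := s) rfl rfl
      (congrArg Subtype.val h))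
  -- Passing to `σ²` removes the sign on `√D`: it fixes `K` and raises `ζ_n` to the power `x²`.
  have hρs : σ (σ s) = s := by
    rcases hsgn σ with h | h <;> simp [h]
  have hρg : σ (σ g) = g := hfixg (σ.trans σ) hρs
  have hρz : ∀ i : ℕ, σ (σ (z ^ i)) = (z ^ i) ^ x ^ 2 := by
    intro i
    simp only [map_pow, hσ]
    ring
  have hcomm : ∀ τ : L ≃ₐ[ℚ] L, ∀ y : L, τ (σ (σ y)) = σ (σ (τ y)) := by
    intro τ y
    have : (τ.toAlgHom.comp (σ.toAlgHom.comp σ.toAlgHom) : L →ₐ[ℚ] L) =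
        σ.toAlgHom.comp (σ.toAlgHom.comp τ.toAlgHom) := by
      refine algHom_ext_of_eq_adjoin (F := ℚ) (s := {sqrtD a₁ a₂, ζ n}) rfl ?_
      intro w hw
      rcases hw with hw | hw
      · obtain rfl := hw
        change τ (σ (σ s)) = σ (σ (τ s))
        rcases hsgn τ with h | h <;> simp [h, hρs]
      · obtain rfl := hw
        change τ (σ (σ z)) = σ (σ (τ z))
        have h1 : (τ z) ^ n = 1 := by rw [← map_pow, hz.pow_eq_one, map_one]
        obtain ⟨i, -, hi⟩ := hz.eq_pow_of_pow_eq_one h1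
        have := hρz 1
        rw [pow_one] at this
        rw [this, ← hi, hρz, map_pow, hi]
    exact congrArg (fun f : L →ₐ[ℚ] L => f y) this
  -- If `τ` fixes `K`, it multiplies `b` by some `ζ_n ^ i`. As `τ` commutes with `σ²`, it multiplies
  -- both `b ^ x²` and `σ² b` by `ζ_n ^ (i x²)`, so it fixes the quotient.
  refine ⟨((b' ^ x ^ 2 / σ (σ b') : L) : ℂ), mem_K_of_fixed hn fun τ hτ => ?_, ?_⟩
  · have hτb : (τ b' / b') ^ n = 1 := by
      obtain ⟨e, rfl⟩ := hdn
      rw [div_pow, pow_mul, pow_mul, ← map_pow, hb', hfixg τ hτ, div_self (pow_ne_zero _ hg0)]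
    obtain ⟨i, -, hi⟩ := hz.eq_pow_of_pow_eq_one hτb
    have hτb' : τ b' = z ^ i * b' := by rw [hi, div_mul_cancel₀ _ hb0]
    have hz0 : z ^ i ≠ 0 := pow_ne_zero _ (hz.ne_zero hn.ne')
    rw [map_div₀, map_pow, hcomm, hτb', map_mul, map_mul, hρz, mul_pow,
      mul_div_mul_left _ _ (pow_ne_zero _ hz0)]
  · have : (b' ^ x ^ 2 / σ (σ b')) ^ d = g ^ ((x : ℤ) ^ 2 - 1) := by
      rw [div_pow, ← map_pow, ← map_pow, hb', hρg, pow_right_comm, hb', zpow_sub_one₀ hg0,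
        div_eq_mul_inv]
      norm_cast
    have h := congrArg L.val this
    rw [map_pow, map_zpow₀] at h
    exact h

/-- If `γ` is a `d`-th power in `K(ζ_n)`, `d ∣ n`, then `γ ^ 24` is a `d`-th power in `K`. -/
theorem exists_pow_eq_γ_pow (h2 : a₂ ≠ 0) {n d : ℕ} (hn : 0 < n) (hdn : d ∣ n) {b : ℂ}
    (hb : b ∈ Ln a₁ a₂ n) (hbd : b ^ d = γ a₁ a₂) :
    ∃ c ∈ K a₁ a₂, c ^ d = γ a₁ a₂ ^ 24 := by
  have hγ0 := γ_ne_zero (a₁ := a₁) h2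
  have hγK : γ a₁ a₂ ∈ K a₁ a₂ := γ_mem (subset_adjoin _ _ rfl)
  -- The exponents `k` for which `γ ^ k` is a `d`-th power in `K`. The generator divides `d`, and it
  -- divides `x² - 1` for all `x` prime to `n`; every residue prime to the generator lifts to such
  -- an `x`, so the generator divides 24.
  let H : AddSubgroup ℤ :=
    { carrier := {k | ∃ c ∈ K a₁ a₂, c ^ d = γ a₁ a₂ ^ k}
      zero_mem' := ⟨1, one_mem _, by simp⟩
      add_mem' := by
        rintro k l ⟨c, hc, h⟩ ⟨c', hc', h'⟩
        exact ⟨c * c', mul_mem hc hc', by rw [mul_pow, h, h', zpow_add₀ hγ0]⟩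
      neg_mem' := by
        rintro k ⟨c, hc, h⟩
        exact ⟨c⁻¹, inv_mem hc, by rw [inv_pow, h, zpow_neg]⟩ }
  obtain ⟨m, hm⟩ := Int.subgroup_cyclic H
  rw [← AddSubgroup.zmultiples_eq_closure, ← Int.zmultiples_natAbs] at hm
  have hmem : ∀ k : ℤ, k ∈ H ↔ (m.natAbs : ℤ) ∣ k := fun k => by
    rw [hm, Int.mem_zmultiples_iff]
  have hd : (d : ℤ) ∈ H := ⟨γ a₁ a₂, hγK, by simp⟩
  have hmd : m.natAbs ∣ d := by exact_mod_cast (hmem d).1 hd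
  have hm0 : 0 < m.natAbs := Nat.pos_of_dvd_of_pos (hmd.trans hdn) hn
  have h24 : (24 : ℤ) ∈ H := by
    rw [hmem]
    have := dvd_twentyfour hm0 fun y hy => by
      obtain ⟨x, hx, hxy⟩ := exists_coprime_modEq hn (hmd.trans hdn) hy
      have h1 : (x : ℤ) ^ 2 - 1 ∈ H := exists_pow_eq_of_coprime h2 hn hdn hb hbd hx
      have h3 : (x : ℤ) ≡ y [ZMOD m.natAbs] := by exact_mod_cast hxy
      exact (((h3.pow 2).sub_right 1).dvd_iff).1 ((hmem _).1 h1)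
    exact_mod_cast this
  obtain ⟨c, hc, h⟩ := h24
  exact ⟨c, hc, by exact_mod_cast h⟩

end LucasIndex

/-! ### The degree of `K_n` and its bounded defect -/

namespace LucasIndex

open IntermediateField Polynomial

variable {a₁ a₂ : ℤ}

theorem finrank_eq_mul_natDegree {F E : IntermediateField ℚ ℂ} {z : ℂ} (hz : IsIntegral F z)
    (hE : E = adjoin ℚ (F ∪ {z})) :
    Module.finrank ℚ E = Module.finrank ℚ F * (minpoly F z).natDegree := by
  subst hE
  rw [← restrictScalars_adjoin, ← adjoin.finrank hz]
  exact (Module.finrank_mul_finrank ℚ F F⟮z⟯).symm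

theorem exists_finrank_Ln_mul_eq {n : ℕ} (hn : 0 < n) :
    ∃ i ≤ 2, Module.finrank ℚ (Ln a₁ a₂ n) * i = 2 * n.totient := by
  have hζ := ζ_isPrimitiveRoot hn
  have hζi : IsIntegral ℚ (ζ n) := hζ.isIntegral hn |>.tower_top
  have h1 : Module.finrank ℚ ℚ⟮ζ n⟯ = n.totient := by
    rw [adjoin.finrank hζi, ← cyclotomic_eq_minpoly_rat hζ hn, natDegree_cyclotomic]
  have hmon : (X ^ 2 - C ((D a₁ a₂ : ℤ) : ℚ⟮ζ n⟯)).Monic := monic_X_pow_sub_C _ two_ne_zero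
  have haev : aeval (sqrtD a₁ a₂) (X ^ 2 - C ((D a₁ a₂ : ℤ) : ℚ⟮ζ n⟯)) = 0 := by
    simp [sqrtD_sq]
  have hsi : IsIntegral ℚ⟮ζ n⟯ (sqrtD a₁ a₂) := ⟨_, hmon, by rwa [← aeval_def]⟩
  have hE : Ln a₁ a₂ n = adjoin ℚ (ℚ⟮ζ n⟯ ∪ {sqrtD a₁ a₂}) := by
    rw [adjoin_union, adjoin_self, ← adjoin_union, Ln, Set.union_comm, Set.insert_eq]
  rw [finrank_eq_mul_natDegree hsi hE, h1]
  have h2 : (minpoly ℚ⟮ζ n⟯ (sqrtD a₁ a₂)).natDegree ≤ 2 := by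
    have := natDegree_le_of_dvd (minpoly.dvd _ _ haev) hmon.ne_zero
    rwa [natDegree_X_pow_sub_C] at this
  have h3 := minpoly.natDegree_pos hsi
  interval_cases (minpoly ℚ⟮ζ n⟯ (sqrtD a₁ a₂)).natDegree
  · exact ⟨2, le_rfl, by ring⟩
  · exact ⟨1, one_le_two, by ring⟩

/-- Principal values make the chosen roots compatible, so that the fields `Kn` increase along
divisibility. -/
theorem γroot_pow {m k : ℕ} (hk : 0 < k) :
    γroot a₁ a₂ (m * k) ^ k = γroot a₁ a₂ m := by
  have hk' : (k : ℂ) ≠ 0 := by exact_mod_cast hk.ne'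
  unfold γroot
  rw [← Complex.cpow_nat_mul]
  congr 1
  push_cast
  field_simp

theorem γroot_pow_self {n : ℕ} (hn : 0 < n) : γroot a₁ a₂ n ^ n = γ a₁ a₂ := by
  simpa [γroot] using γroot_pow (a₁ := a₁) (a₂ := a₂) (m := 1) hn

theorem ζ_pow {m k : ℕ} (hm : 0 < m) (hk : 0 < k) : ζ (m * k) ^ k = ζ m := by
  have hk' : (k : ℂ) ≠ 0 := by exact_mod_cast hk.ne'
  have hm' : (m : ℂ) ≠ 0 := by exact_mod_cast hm.ne'
  unfold ζ
  rw [← Complex.exp_nat_mul]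
  congr 1
  push_cast
  field_simp

theorem γroot_ne_zero {n : ℕ} (h2 : a₂ ≠ 0) (hn : 0 < n) : γroot a₁ a₂ n ≠ 0 := by
  intro h
  have := γroot_pow_self (a₁ := a₁) (a₂ := a₂) hn
  rw [h, zero_pow hn.ne'] at this
  exact γ_ne_zero h2 this.symm

theorem Multiset.exists_prod_eq_pow_mul {F : IntermediateField ℚ ℂ} {z : ℂ} (R : Multiset ℂ)
    (h : ∀ r ∈ R, ∃ w ∈ F, r = z * w) : ∃ w ∈ F, R.prod = z ^ R.card * w := by
  induction R using Multiset.induction with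
  | empty => exact ⟨1, one_mem _, by simp⟩
  | cons r R ih =>
    obtain ⟨w, hw, hR⟩ := ih fun r hr => h r (Multiset.mem_cons_of_mem hr)
    obtain ⟨w', hw', hr⟩ := h r (Multiset.mem_cons_self r R)
    refine ⟨w' * w, mul_mem hw' hw, ?_⟩
    rw [Multiset.prod_cons, hR, hr, Multiset.card_cons]
    ring

/-- If `z ^ n` lies in `F`, and `F` contains the `n`-th roots of unity, then the degree `m` of `z`
over `F` divides `n`, and `z ^ m` lies in `F`. -/
theorem natDegree_minpoly_dvd {F : IntermediateField ℚ ℂ} {z : ℂ} {n : ℕ} (hn : 0 < n)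
    (hz0 : z ≠ 0) (hzn : z ^ n ∈ F) (hF : ∀ w : ℂ, w ^ n = 1 → w ∈ F) :
    IsIntegral F z ∧ (minpoly F z).natDegree ∣ n ∧ z ^ (minpoly F z).natDegree ∈ F := by
  have aux : ∀ k : ℕ, 0 < k → ∀ hk : z ^ k ∈ F, aeval z (X ^ k - C (⟨z ^ k, hk⟩ : F)) = 0 := by
    intro k _ hk
    simp
  have hz : IsIntegral F z := ⟨X ^ n - C ⟨z ^ n, hzn⟩, monic_X_pow_sub_C _ hn.ne', by
    rw [← aeval_def]; exact aux n hn hzn⟩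
  set m := (minpoly F z).natDegree with hm
  have hm0 : 0 < m := minpoly.natDegree_pos hz
  have hle : ∀ k : ℕ, 0 < k → z ^ k ∈ F → m ≤ k := by
    intro k hk hkF
    simpa using natDegree_le_of_dvd (minpoly.dvd _ _ (aux k hk hkF))
      (monic_X_pow_sub_C (⟨z ^ k, hkF⟩ : F) hk.ne').ne_zero
  have hspl : ((minpoly F z).map (algebraMap F ℂ)).Splits := IsAlgClosed.splits _
  have hmon : ((minpoly F z).map (algebraMap F ℂ)).Monic := (minpoly.monic hz).map _
  have hprod := hspl.coeff_zero_eq_prod_roots_of_monic hmon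
  -- Conjugates of `z` differ from it by `n`-th roots of unity, which lie in `F`. Their product, the
  -- norm up to sign, is then `z ^ m` times an element of `F`.
  have hroots : ∀ r ∈ ((minpoly F z).map (algebraMap F ℂ)).roots, ∃ w ∈ F, r = z * w := by
    intro r hr
    rw [mem_roots hmon.ne_zero, IsRoot, eval_map_algebraMap] at hr
    have h1 : aeval r (X ^ n - C (⟨z ^ n, hzn⟩ : F)) = 0 :=
      aeval_eq_zero_of_dvd_aeval_eq_zero (minpoly.dvd _ _ (aux n hn hzn)) hr
    have h2 : r ^ n = z ^ n := by simpa [sub_eq_zero] using h1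
    refine ⟨r / z, hF _ ?_, by field_simp⟩
    rw [div_pow, h2, div_self (pow_ne_zero _ hz0)]
  obtain ⟨w, hw, hR⟩ := Multiset.exists_prod_eq_pow_mul _ hroots
  have hcard : ((minpoly F z).map (algebraMap F ℂ)).roots.card = m := by
    rw [← hspl.natDegree_eq_card_roots, natDegree_map]
  rw [hR, hcard, natDegree_map, ← hm, coeff_map] at hprod
  have hzm : z ^ m ∈ F := by
    have hc0 : (minpoly F z).coeff 0 ≠ 0 := minpoly.coeff_zero_ne_zero hz hz0
    have hw0 : w ≠ 0 := by
      rintro rfl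
      simp only [mul_zero] at hprod
      exact hc0 (by simpa using hprod)
    have : z ^ m = algebraMap F ℂ ((minpoly F z).coeff 0) / ((-1) ^ m * w) := by
      rw [hprod]
      have : ((-1 : ℂ)) ^ m ≠ 0 := pow_ne_zero _ (by norm_num)
      field_simp
    rw [this]
    exact div_mem (SetLike.coe_mem _) (mul_mem (pow_mem (neg_mem (one_mem _)) _) hw)
  refine ⟨hz, ?_, hzm⟩
  have hg0 : 0 < m.gcd n := Nat.gcd_pos_of_pos_left _ hm0
  -- Bézout; as `m` is the degree of `z`, no smaller positive power lies in `F`, hence `gcd m n =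
  -- m`.
  have hg : z ^ (m.gcd n) ∈ F := by
    have : z ^ (m.gcd n) = (z ^ m) ^ (m.gcdA n) * (z ^ n) ^ (m.gcdB n) := by
      rw [← zpow_natCast, Nat.gcd_eq_gcd_ab, zpow_add₀ hz0, zpow_mul, zpow_mul, zpow_natCast,
        zpow_natCast]
    rw [this]
    exact mul_mem (zpow_mem hzm _) (zpow_mem hzn _)
  have := hle _ hg0 hg
  rw [← Nat.le_antisymm (Nat.gcd_le_left _ hm0) this]
  exact Nat.gcd_dvd_right m n

/-- Here `n / d` is the degree of `γ^{1/n}` over `K(ζ_n)`, and `b` is its `(n / d)`-th power. -/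
theorem exists_finrank_Kn_mul_eq (h2 : a₂ ≠ 0) {n : ℕ} (hn : 0 < n) :
    ∃ d : ℕ, 0 < d ∧ d ∣ n ∧ (∃ b ∈ Ln a₁ a₂ n, b ^ d = γ a₁ a₂) ∧
      Module.finrank ℚ (Kn a₁ a₂ n) * d = Module.finrank ℚ (Ln a₁ a₂ n) * n := by
  have hz0 := γroot_ne_zero (a₁ := a₁) h2 hn
  have hzn := γroot_pow_self (a₁ := a₁) (a₂ := a₂) hn
  obtain ⟨hz, ⟨d, hd⟩, hb⟩ := natDegree_minpoly_dvd (F := Ln a₁ a₂ n) hn hz0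
    (hzn ▸ γ_mem (sqrtD_mem_Ln a₁ a₂ n)) fun w hw => mem_Ln_of_pow_eq_one hn hw
  have hE : Kn a₁ a₂ n = adjoin ℚ (Ln a₁ a₂ n ∪ {γroot a₁ a₂ n}) := by
    rw [adjoin_union, adjoin_self, Ln, ← adjoin_union, Kn]
    congr 1
    ext x
    simp
    tauto
  refine ⟨d, ?_, Dvd.intro_left _ hd.symm, ⟨_, hb, ?_⟩, ?_⟩
  · rcases Nat.eq_zero_or_pos d with rfl | h
    · omega
    · exact h
  · rw [← pow_mul, ← hd, hzn]
  · rw [finrank_eq_mul_natDegree hz hE, mul_assoc, ← hd]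

/-- The defect `2 φ(n) n / [K_n : ℚ]` is a bounded integer. -/
theorem exists_defect (h2 : a₂ ≠ 0) (hD : ¬ IsSquare (D a₁ a₂)) (hnd : Nondegenerate a₁ a₂) :
    ∃ (B : ℕ) (e : ℕ → ℕ), ∀ n : ℕ, 0 < n →
      e n ≤ B ∧ Module.finrank ℚ (Kn a₁ a₂ n) * e n = 2 * psi n := by
  obtain ⟨B, hB⟩ := exists_bound_pow_eq h2 hD hnd
  have h : ∀ n : ℕ, ∃ e : ℕ, 0 < n →
      e ≤ 2 * B ∧ Module.finrank ℚ (Kn a₁ a₂ n) * e = 2 * psi n := by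
    intro n
    rcases Nat.eq_zero_or_pos n with rfl | hn
    · exact ⟨0, fun h => absurd h (lt_irrefl 0)⟩
    obtain ⟨d, hd0, hdn, ⟨b, hb, hbd⟩, hd⟩ := exists_finrank_Kn_mul_eq (a₁ := a₁) h2 hn
    obtain ⟨c, hc, hcd⟩ := exists_pow_eq_γ_pow h2 hn hdn hb hbd
    have hdB := hB d hd0 c hc hcd
    obtain ⟨i, hi2, hi⟩ := exists_finrank_Ln_mul_eq (a₁ := a₁) (a₂ := a₂) hn
    refine ⟨i * d, fun _ => ⟨Nat.mul_le_mul hi2 hdB, ?_⟩⟩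
    unfold psi
    rw [mul_left_comm, hd, ← mul_assoc 2, ← hi]
    ring
  choose e he using h
  exact ⟨2 * B, e, he⟩

end LucasIndex

/-! ### Conjugates of `(ζ_n, γ^{1/n})` and the level beyond which they are maximal -/

namespace LucasIndex

open IntermediateField Polynomial

variable {a₁ a₂ : ℤ}

section RootCounts

open scoped Classical in
-- Write `v = w ^ i` and lift `i` to `x` prime to `m k`: raising to the power `x` injects one fibre
-- into the other. By symmetry all fibres have the same size.
theorem card_primitiveRoots_fiber_le {m k : ℕ} (hm : 0 < m) (hk : 0 < k) {w v : ℂ}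
    (hw : IsPrimitiveRoot w m) (hv : IsPrimitiveRoot v m) :
    ((primitiveRoots (m * k) ℂ).filter fun z => z ^ k = w).card ≤
      ((primitiveRoots (m * k) ℂ).filter fun z => z ^ k = v).card := by
  have hmk : 0 < m * k := Nat.mul_pos hm hk
  have := NeZero.of_pos hm
  obtain ⟨i, -, hi, rfl⟩ := hw.isPrimitiveRoot_iff.1 hv
  obtain ⟨x, hx, hxi⟩ := exists_coprime_modEq hmk (Dvd.intro k rfl) hi
  refine Finset.card_le_card_of_injOn (fun z => z ^ x) ?_ ?_
  · intro z hz
    simp only [Finset.coe_filter, Set.mem_ofPred_eq, mem_primitiveRoots hmk] at hz ⊢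
    refine ⟨hz.1.pow_of_coprime x hx, ?_⟩
    rw [pow_right_comm, hz.2]
    rw [pow_eq_pow_mod x hw.pow_eq_one, pow_eq_pow_mod i hw.pow_eq_one, hxi]
  · intro u hu z hz huz
    simp only [Finset.coe_filter, Set.mem_ofPred_eq, mem_primitiveRoots hmk] at hu hz
    have hz0 : z ≠ 0 := hz.1.ne_zero hmk.ne'
    have h1 : (u / z) ^ x = 1 := by
      rw [div_pow, show u ^ x = z ^ x from huz, div_self (pow_ne_zero _ hz0)]
    have h2 : (u / z) ^ (m * k) = 1 := by
      rw [div_pow, hu.1.pow_eq_one, hz.1.pow_eq_one, div_one]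
    have h3 := pow_gcd_eq_one.2 ⟨h1, h2⟩
    rw [hx.gcd_eq_one, pow_one, div_eq_one_iff_eq hz0] at h3
    exact h3

open scoped Classical in
theorem card_primitiveRoots_fiber {m k : ℕ} (hm : 0 < m) (hk : 0 < k) {w : ℂ}
    (hw : IsPrimitiveRoot w m) :
    m.totient * ((primitiveRoots (m * k) ℂ).filter fun z => z ^ k = w).card =
      (m * k).totient := by
  have hmk : 0 < m * k := Nat.mul_pos hm hk
  have h := Finset.card_eq_sum_card_fiberwise (f := fun z : ℂ => z ^ k)
    (s := primitiveRoots (m * k) ℂ) (t := primitiveRoots m ℂ) (fun z hz => by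
      simp only [Finset.mem_coe, mem_primitiveRoots hmk, mem_primitiveRoots hm] at hz ⊢
      exact hz.pow hmk (mul_comm m k))
  rw [(ζ_isPrimitiveRoot hmk).card_primitiveRoots, Finset.sum_congr rfl fun v hv => ?_,
    Finset.sum_const, (ζ_isPrimitiveRoot hm).card_primitiveRoots, smul_eq_mul] at h
  · exact h.symm
  · have hv' := (mem_primitiveRoots hm).1 hv
    exact le_antisymm (card_primitiveRoots_fiber_le hm hk hv' hw)
      (card_primitiveRoots_fiber_le hm hk hw hv')

end RootCounts

/-- The map raising both coordinates to the `k`-th power. -/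
def powPair (k : ℕ) (p : ℂ × ℂ) : ℂ × ℂ := (p.1 ^ k, p.2 ^ k)

/-- The pairs consisting of a primitive `n`-th root of unity and of an `n`-th root of `γ` or
of `γ⁻¹`. -/
def rootPairs (a₁ a₂ : ℤ) (n : ℕ) : Set (ℂ × ℂ) :=
  {p | IsPrimitiveRoot p.1 n ∧ (p.2 ^ n = γ a₁ a₂ ∨ p.2 ^ n = (γ a₁ a₂)⁻¹)}

/-- The conjugates over `ℚ` of the pair `(ζ_n, γ^{1/n})`. -/
def conjPairs (a₁ a₂ : ℤ) (n : ℕ) : Set (ℂ × ℂ) :=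
  Set.range fun φ : Kn a₁ a₂ n →ₐ[ℚ] ℂ => (φ (ζK a₁ a₂ n), φ (γrootK a₁ a₂ n))

theorem rootPairs_finite (a₁ a₂ : ℤ) {n : ℕ} (hn : 0 < n) : (rootPairs a₁ a₂ n).Finite := by
  have h : ∀ c : ℂ, {y : ℂ | y ^ n = c}.Finite := fun c =>
    (nthRoots n c).toFinset.finite_toSet.subset fun y hy => by
      simpa [mem_nthRoots hn] using hy
  refine ((h 1).prod ((h (γ a₁ a₂)).union (h (γ a₁ a₂)⁻¹))).subset ?_
  rintro ⟨x, y⟩ ⟨hx, hy⟩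
  exact ⟨hx.pow_eq_one, hy⟩

open scoped Classical in
-- The first coordinate has `φ(m k) / φ(m)` choices and the second, independently, has `k`.
theorem ncard_powPair_fiber {m k : ℕ} (hm : 0 < m) (hk : 0 < k) (h2 : a₂ ≠ 0) {q : ℂ × ℂ}
    (hq : q ∈ rootPairs a₁ a₂ m) :
    psi m * {p | p ∈ rootPairs a₁ a₂ (m * k) ∧ powPair k p = q}.ncard = psi (m * k) := by
  obtain ⟨w, y⟩ := q
  obtain ⟨hw, hy⟩ := hq
  simp only at hw hy
  have hmk : 0 < m * k := Nat.mul_pos hm hk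
  have hy0 : y ≠ 0 := by
    rintro rfl
    rw [zero_pow hm.ne'] at hy
    rcases hy with h | h
    · exact γ_ne_zero h2 h.symm
    · exact inv_ne_zero (γ_ne_zero h2) h.symm
  have hset : {p | p ∈ rootPairs a₁ a₂ (m * k) ∧ powPair k p = (w, y)} =
      (((primitiveRoots (m * k) ℂ).filter fun z => z ^ k = w) ×ˢ (nthRoots k y).toFinset :
        Finset (ℂ × ℂ)) := by
    ext ⟨u, v⟩
    simp only [rootPairs, powPair, Set.mem_ofPred_eq, Prod.mk.injEq, Finset.coe_product,
      Set.mem_prod, Finset.mem_coe, Finset.mem_filter, mem_primitiveRoots hmk,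
      Multiset.mem_toFinset, mem_nthRoots hk]
    constructor
    · rintro ⟨⟨h1, -⟩, h3, h4⟩
      exact ⟨⟨h1, h3⟩, h4⟩
    · rintro ⟨⟨h1, h3⟩, h4⟩
      refine ⟨⟨h1, ?_⟩, h3, h4⟩
      rwa [mul_comm, pow_mul, h4]
  have hB : (nthRoots k y).toFinset.card = k := by
    have hζ := ζ_isPrimitiveRoot hk
    rw [Multiset.toFinset_card_of_nodup (hζ.nthRoots_nodup hy0), hζ.card_nthRoots,
      if_pos (IsAlgClosed.exists_pow_nat_eq y hk)]
  rw [hset, Set.ncard_coe_finset, Finset.card_product, hB]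
  have := card_primitiveRoots_fiber hm hk hw
  unfold psi
  rw [← this]
  ring

open scoped Classical in
theorem ncard_powPair_preimage {m k : ℕ} (hm : 0 < m) (hk : 0 < k) (h2 : a₂ ≠ 0)
    {S : Set (ℂ × ℂ)} (hS : S ⊆ rootPairs a₁ a₂ m) :
    psi m * {p | p ∈ rootPairs a₁ a₂ (m * k) ∧ powPair k p ∈ S}.ncard =
      S.ncard * psi (m * k) := by
  have hSf : S.Finite := (rootPairs_finite a₁ a₂ hm).subset hS
  have hPf : {p | p ∈ rootPairs a₁ a₂ (m * k) ∧ powPair k p ∈ S}.Finite :=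
    (rootPairs_finite a₁ a₂ (Nat.mul_pos hm hk)).subset fun p hp => hp.1
  rw [Set.ncard_eq_toFinset_card _ hPf, Set.ncard_eq_toFinset_card _ hSf,
    Finset.card_eq_sum_card_fiberwise (f := powPair k) (t := hSf.toFinset)
      (fun p hp => by simp at hp ⊢; exact hp.2), Finset.mul_sum, Finset.sum_congr rfl,
    Finset.sum_const, smul_eq_mul]
  intro q hq
  rw [Set.Finite.mem_toFinset] at hq
  rw [← ncard_powPair_fiber hm hk h2 (hS hq), ← Set.ncard_coe_finset]
  congr 2
  ext p
  simp only [Finset.coe_filter, Set.Finite.mem_toFinset, Set.mem_ofPred_eq]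
  refine ⟨fun h => ⟨h.1.1, h.2⟩, fun h => ⟨⟨h.1, h.2 ▸ hq⟩, h.2⟩⟩

theorem sqrtD_mem_Kn (a₁ a₂ : ℤ) (n : ℕ) : sqrtD a₁ a₂ ∈ Kn a₁ a₂ n :=
  subset_adjoin _ _ (by simp)

theorem isIntegral_of_pow_eq_γ {n : ℕ} (hn : 0 < n) {z : ℂ}
    (hz : z ^ n = γ a₁ a₂) : IsIntegral ℚ z := by
  refine IsIntegral.of_pow hn ?_
  rw [hz]
  have h : IsAlgebraic ℚ (⟨γ a₁ a₂, γ_mem (subset_adjoin _ _ rfl)⟩ : K a₁ a₂) :=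
    Algebra.IsAlgebraic.isAlgebraic _
  exact (h.isIntegral.map (K a₁ a₂).val)

theorem isIntegral_of_mem_generators {n : ℕ} (hn : 0 < n) {x : ℂ}
    (hx : x ∈ ({sqrtD a₁ a₂, ζ n, γroot a₁ a₂ n} : Set ℂ)) : IsIntegral ℚ x := by
  rcases hx with rfl | rfl | rfl
  · exact isIntegral_sqrtD _ _
  · exact ((ζ_isPrimitiveRoot hn).isIntegral hn).tower_top
  · exact isIntegral_of_pow_eq_γ hn (γroot_pow_self hn)

theorem finiteDimensional_Kn {n : ℕ} (hn : 0 < n) :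
    FiniteDimensional ℚ (Kn a₁ a₂ n) :=
  finiteDimensional_adjoin fun _ hx => isIntegral_of_mem_generators hn hx

theorem γrootK_pow {n : ℕ} (hn : 0 < n) :
    ((γrootK a₁ a₂ n ^ n : Kn a₁ a₂ n) : ℂ) = γ a₁ a₂ := by
  exact γroot_pow_self hn

/-- The generator `√D` is redundant by `sqrtD_eq`. Hence embeddings can be counted as conjugate
pairs. -/
theorem Kn_algHom_ext (h1 : a₁ ≠ 0) (h2 : a₂ ≠ 0) {n : ℕ} (hn : 0 < n)
    {φ ψ : Kn a₁ a₂ n →ₐ[ℚ] ℂ} (hζ : φ (ζK a₁ a₂ n) = ψ (ζK a₁ a₂ n))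
    (hγ : φ (γrootK a₁ a₂ n) = ψ (γrootK a₁ a₂ n)) : φ = ψ := by
  refine algHom_ext_of_eq_adjoin (F := ℚ) (s := {sqrtD a₁ a₂, ζ n, γroot a₁ a₂ n}) rfl ?_
  intro x hx
  rcases hx with hx | hx | hx
  · obtain rfl := hx
    let s : Kn a₁ a₂ n := ⟨_, sqrtD_mem_Kn a₁ a₂ n⟩
    have ha : ((2 * a₁ : ℤ) : Kn a₁ a₂ n) ≠ 0 := by
      exact_mod_cast mul_ne_zero two_ne_zero h1
    have hs : s = ((-4 * a₂ : ℤ) * γrootK a₁ a₂ n ^ n - ((a₁ ^ 2 : ℤ) : Kn a₁ a₂ n)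
        - ((D a₁ a₂ : ℤ) : Kn a₁ a₂ n)) / ((2 * a₁ : ℤ) : Kn a₁ a₂ n) := by
      refine Subtype.ext ?_
      have := γrootK_pow (a₁ := a₁) (a₂ := a₂) hn
      push_cast at this ⊢
      rw [this]
      exact sqrtD_eq h1 h2
    change φ s = ψ s
    rw [hs]
    simp only [map_div₀, map_sub, map_mul, map_pow, map_intCast, hγ]
  · obtain rfl := hx
    exact hζ
  · obtain rfl := hx
    exact hγ

theorem ncard_conjPairs (h1 : a₁ ≠ 0) (h2 : a₂ ≠ 0) {n : ℕ} (hn : 0 < n) :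
    (conjPairs a₁ a₂ n).ncard = Module.finrank ℚ (Kn a₁ a₂ n) := by
  have := finiteDimensional_Kn (a₁ := a₁) (a₂ := a₂) hn
  have hinj : Function.Injective
      fun φ : Kn a₁ a₂ n →ₐ[ℚ] ℂ => (φ (ζK a₁ a₂ n), φ (γrootK a₁ a₂ n)) := by
    intro φ ψ h
    simp only [Prod.mk.injEq] at h
    exact Kn_algHom_ext h1 h2 hn h.1 h.2
  rw [conjPairs, ← Nat.card_coe_set_eq, Nat.card_range_of_injective hinj,
    ← AlgHom.card ℚ (Kn a₁ a₂ n) ℂ, Nat.card_eq_fintype_card]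

theorem conjPairs_subset (h2 : a₂ ≠ 0) {n : ℕ} (hn : 0 < n) :
    conjPairs a₁ a₂ n ⊆ rootPairs a₁ a₂ n := by
  rintro _ ⟨φ, rfl⟩
  constructor
  · have : IsPrimitiveRoot (ζK a₁ a₂ n) n :=
      IsPrimitiveRoot.of_map_of_injective (f := (Kn a₁ a₂ n).val) (ζ_isPrimitiveRoot hn)
        (Kn a₁ a₂ n).val.injective
    exact this.map_of_injective φ.injective
  · simp only
    rw [← map_pow]
    exact map_γ h2 φ (s := ⟨_, sqrtD_mem_Kn a₁ a₂ n⟩) rfl (γrootK_pow hn)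

theorem Kn_le {m k : ℕ} (hm : 0 < m) (hk : 0 < k) : Kn a₁ a₂ m ≤ Kn a₁ a₂ (m * k) := by
  refine adjoin_le_iff.2 ?_
  rintro x (rfl | rfl | rfl)
  · exact sqrtD_mem_Kn _ _ _
  · rw [← ζ_pow hm hk]
    exact pow_mem (subset_adjoin _ _ (by simp)) k
  · rw [← γroot_pow hk]
    exact pow_mem (subset_adjoin _ _ (by simp)) k

theorem inclusion_ζK {m k : ℕ} (hm : 0 < m) (hk : 0 < k) :
    inclusion (Kn_le hm hk) (ζK a₁ a₂ m) = ζK a₁ a₂ (m * k) ^ k :=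
  Subtype.ext (ζ_pow hm hk).symm

theorem inclusion_γrootK {m k : ℕ} (hm : 0 < m) (hk : 0 < k) :
    inclusion (Kn_le hm hk) (γrootK a₁ a₂ m) = γrootK a₁ a₂ (m * k) ^ k :=
  Subtype.ext (γroot_pow hk).symm

theorem powPair_mem_conjPairs {m k : ℕ} (hm : 0 < m) (hk : 0 < k) {p : ℂ × ℂ}
    (hp : p ∈ conjPairs a₁ a₂ (m * k)) : powPair k p ∈ conjPairs a₁ a₂ m := by
  obtain ⟨φ, rfl⟩ := hp
  refine ⟨φ.comp (inclusion (Kn_le hm hk)), ?_⟩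
  exact Prod.ext ((congrArg φ (inclusion_ζK hm hk)).trans (map_pow φ _ _))
    ((congrArg φ (inclusion_γrootK hm hk)).trans (map_pow φ _ _))

theorem exists_powPair_eq {m k : ℕ} (hm : 0 < m) (hk : 0 < k) {q : ℂ × ℂ}
    (hq : q ∈ conjPairs a₁ a₂ m) : ∃ p ∈ conjPairs a₁ a₂ (m * k), powPair k p = q := by
  obtain ⟨φ, rfl⟩ := hq
  obtain ⟨ψ, hψ⟩ := exists_algHom_adjoin_of_splits (F := ℚ) (K := ℂ)
    (S := {sqrtD a₁ a₂, ζ (m * k), γroot a₁ a₂ (m * k)})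
    (fun x hx => ⟨isIntegral_of_mem_generators (Nat.mul_pos hm hk) hx, IsAlgClosed.splits _⟩)
    φ (Kn_le hm hk)
  refine ⟨_, ⟨ψ, rfl⟩, ?_⟩
  rw [← hψ]
  exact Prod.ext ((congrArg ψ (inclusion_ζK hm hk)).trans (map_pow ψ _ _)).symm
    ((congrArg ψ (inclusion_γrootK hm hk)).trans (map_pow ψ _ _)).symm

theorem exists_pow_eq_and_pow_eq {a b : ℕ} (hab : a.Coprime b) {x y : ℂ} (hx : x ≠ 0)
    (hy : y ≠ 0) (h : x ^ a = y ^ b) : ∃ z : ℂ, z ^ b = x ∧ z ^ a = y := by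
  obtain ⟨r, s, hrs⟩ := Nat.isCoprime_iff_coprime.2 hab
  refine ⟨x ^ s * y ^ r, ?_, ?_⟩
  · calc (x ^ s * y ^ r) ^ b = x ^ (s * b) * (y ^ b) ^ r := by
          rw [mul_pow, ← zpow_natCast, ← zpow_natCast (y ^ r), ← zpow_mul, ← zpow_mul,
            ← zpow_natCast y, ← zpow_mul, mul_comm (b : ℤ) r]
      _ = x ^ (r * a + s * b) := by
          rw [← h, ← zpow_natCast x, ← zpow_mul, ← zpow_add₀ hx]
          congr 1
          ring
      _ = x := by rw [hrs, zpow_one]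
  · calc (x ^ s * y ^ r) ^ a = (x ^ a) ^ s * y ^ (r * a) := by
          rw [mul_pow, ← zpow_natCast, ← zpow_natCast (y ^ r), ← zpow_mul, ← zpow_mul,
            ← zpow_natCast x, ← zpow_mul, mul_comm (a : ℤ) s]
      _ = y ^ (r * a + s * b) := by
          rw [h, ← zpow_natCast y, ← zpow_mul, ← zpow_add₀ hy]
          congr 1
          ring
      _ = y := by rw [hrs, zpow_one]

theorem rootPairs_ne_zero (h2 : a₂ ≠ 0) {n : ℕ} (hn : 0 < n) {p : ℂ × ℂ}
    (hp : p ∈ rootPairs a₁ a₂ n) : p.1 ≠ 0 ∧ p.2 ≠ 0 := by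
  refine ⟨hp.1.ne_zero hn.ne', fun h => ?_⟩
  have := hp.2
  rw [h, zero_pow hn.ne'] at this
  rcases this with h | h
  · exact γ_ne_zero h2 h.symm
  · exact inv_ne_zero (γ_ne_zero h2) h.symm

/-- Bézout for `a` and `b` gives common roots of the coordinates; the first has exact order `lcm (g
a) (g b) = g a b`. -/
theorem exists_glue {g a b : ℕ} (h2 : a₂ ≠ 0) (hg : 0 < g) (ha : 0 < a) (hb : 0 < b)
    (hab : a.Coprime b) {p q : ℂ × ℂ} (hp : p ∈ rootPairs a₁ a₂ (g * a))
    (hq : q ∈ rootPairs a₁ a₂ (g * b)) (hpq : powPair a p = powPair b q) :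
    ∃ r ∈ rootPairs a₁ a₂ (g * a * b), powPair b r = p ∧ powPair a r = q := by
  obtain ⟨hp1, hp2⟩ := rootPairs_ne_zero h2 (Nat.mul_pos hg ha) hp
  obtain ⟨hq1, hq2⟩ := rootPairs_ne_zero h2 (Nat.mul_pos hg hb) hq
  simp only [powPair, Prod.mk.injEq] at hpq
  obtain ⟨z, hz1, hz2⟩ := exists_pow_eq_and_pow_eq hab hp1 hq1 hpq.1
  obtain ⟨w, hw1, hw2⟩ := exists_pow_eq_and_pow_eq hab hp2 hq2 hpq.2
  refine ⟨(z, w), ⟨⟨?_, fun l hl => ?_⟩, ?_⟩, Prod.ext hz1 hw1, Prod.ext hz2 hw2⟩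
  · rw [mul_comm, pow_mul, hz1, hp.1.pow_eq_one]
  · simp only at hl
    have h3 : g * a ∣ l := by
      refine hp.1.dvd_of_pow_eq_one l ?_
      rw [← hz1, pow_right_comm, hl, one_pow]
    have h4 : g * b ∣ l := by
      refine hq.1.dvd_of_pow_eq_one l ?_
      rw [← hz2, pow_right_comm, hl, one_pow]
    have := Nat.lcm_dvd h3 h4
    rwa [Nat.lcm_mul_left, hab.lcm_eq_mul, ← mul_assoc] at this
  · simp only
    rw [mul_comm, pow_mul, hw1]
    exact hp.2

/-- There is `M` such that, over the multiples of `M`, every root pair over a conjugate pair of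
level `M` is a conjugate pair. -/
theorem exists_saturated_level (h1 : a₁ ≠ 0) (h2 : a₂ ≠ 0) (hD : ¬ IsSquare (D a₁ a₂))
    (hnd : Nondegenerate a₁ a₂) :
    ∃ M : ℕ, 0 < M ∧ ∀ k : ℕ, 0 < k → ∀ p ∈ rootPairs a₁ a₂ (M * k),
      powPair k p ∈ conjPairs a₁ a₂ M → p ∈ conjPairs a₁ a₂ (M * k) := by
  obtain ⟨B, e, he⟩ := exists_defect h2 hD hnd
  -- A level of maximal defect. Over it there are `2 psi (M k) / e M` root pairs, at most the number
  -- `2 psi (M k) / e (M k)` of conjugate pairs, so the inclusion `hsub` is an equality.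
  obtain ⟨M, hM, hmax⟩ : ∃ M, 0 < M ∧ ∀ n, 0 < n → e n ≤ e M := by
    have hne : (e '' Set.Ioi 0).Nonempty := ⟨e 1, 1, Nat.one_pos, rfl⟩
    have hbdd : BddAbove (e '' Set.Ioi 0) := ⟨B, by rintro _ ⟨n, hn, rfl⟩; exact (he n hn).1⟩
    obtain ⟨M, hM, hMe⟩ := Nat.sSup_mem hne hbdd
    exact ⟨M, hM, fun n hn => hMe ▸ le_csSup hbdd ⟨n, hn, rfl⟩⟩
  refine ⟨M, hM, fun k hk p hp hpM => ?_⟩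
  have hMk := Nat.mul_pos hM hk
  have hcard := ncard_powPair_preimage hM hk h2 (conjPairs_subset (a₁ := a₁) h2 hM)
  have hsub : conjPairs a₁ a₂ (M * k) ⊆
      {p | p ∈ rootPairs a₁ a₂ (M * k) ∧ powPair k p ∈ conjPairs a₁ a₂ M} := fun p hp =>
    ⟨conjPairs_subset h2 hMk hp, powPair_mem_conjPairs hM hk hp⟩
  have hfin : {p | p ∈ rootPairs a₁ a₂ (M * k) ∧ powPair k p ∈ conjPairs a₁ a₂ M}.Finite :=
    (rootPairs_finite a₁ a₂ hMk).subset fun p hp => hp.1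
  have heM := (he M hM).2
  have hek := (he (M * k) hMk).2
  rw [← ncard_conjPairs h1 h2 hM] at heM
  rw [← ncard_conjPairs h1 h2 hMk] at hek
  have hpM0 := psi_pos hM
  have heM0 : 0 < e M := by
    rcases Nat.eq_zero_or_pos (e M) with h | h
    · rw [h] at heM; omega
    · exact h
  set P := {p | p ∈ rootPairs a₁ a₂ (M * k) ∧ powPair k p ∈ conjPairs a₁ a₂ M}
  have h3 : P.ncard * e M = 2 * psi (M * k) := by
    refine Nat.eq_of_mul_eq_mul_left hpM0 ?_
    rw [← mul_assoc, hcard, mul_right_comm, heM]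
    ring
  have h4 : P.ncard ≤ (conjPairs a₁ a₂ (M * k)).ncard := by
    refine Nat.le_of_mul_le_mul_right ?_ heM0
    rw [h3, ← hek]
    exact Nat.mul_le_mul_left _ (hmax _ hMk)
  rw [Set.eq_of_subset_of_ncard_le hsub h4 hfin]
  exact ⟨hp, hpM⟩

/-- Lift `powPair a p` to a conjugate pair `q` of level `g b = M c` and glue `p` with `q`. The
result lies over the same pair of level `M` as `q`, so it is conjugate by saturation, and so is its
power `p`. -/
theorem mem_conjPairs_of_saturated {M c g a b : ℕ} (h2 : a₂ ≠ 0) (hM : 0 < M) (hc : 0 < c)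
    (hg : 0 < g) (ha : 0 < a) (hb : 0 < b) (hab : a.Coprime b) (hgb : g * b = M * c)
    (hsat : ∀ k : ℕ, 0 < k → ∀ p ∈ rootPairs a₁ a₂ (M * k),
      powPair k p ∈ conjPairs a₁ a₂ M → p ∈ conjPairs a₁ a₂ (M * k))
    {p : ℂ × ℂ} (hp : p ∈ rootPairs a₁ a₂ (g * a)) (hpg : powPair a p ∈ conjPairs a₁ a₂ g) :
    p ∈ conjPairs a₁ a₂ (g * a) := by
  obtain ⟨q, hq, hqp⟩ := exists_powPair_eq hg hb hpg
  obtain ⟨r, hr, hrp, hrq⟩ := exists_glue h2 hg ha hb hab hp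
    (conjPairs_subset h2 (Nat.mul_pos hg hb) hq) hqp.symm
  rw [← hrp]
  refine powPair_mem_conjPairs (Nat.mul_pos hg ha) hb ?_
  have hl : g * a * b = M * (c * a) := by
    rw [mul_right_comm, hgb, mul_assoc]
  rw [hl] at hr ⊢
  refine hsat _ (Nat.mul_pos hc ha) r hr ?_
  have hpow : powPair (c * a) r = powPair c q := by
    rw [← hrq, mul_comm]
    simp only [powPair, pow_mul]
  rw [hgb] at hq
  rw [hpow]
  exact powPair_mem_conjPairs hM hc hq

/-- Kummer theory for the extensions `K_n`: there is a level `M₀` such that, for every multiple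
`M` of `M₀`, the extension `K_n / K_g` with `g = gcd n M` is as large as possible. -/
theorem exists_level (h1 : a₁ ≠ 0) (h2 : a₂ ≠ 0) (hD : ¬ IsSquare (D a₁ a₂))
    (hnd : Nondegenerate a₁ a₂) :
    ∃ M₀ : ℕ, 0 < M₀ ∧ ∀ M : ℕ, 0 < M → M₀ ∣ M → ∀ n : ℕ, 0 < n →
      ∀ p ∈ rootPairs a₁ a₂ n, powPair (n / n.gcd M) p ∈ conjPairs a₁ a₂ (n.gcd M) →
        p ∈ conjPairs a₁ a₂ n := by
  obtain ⟨M₀, hM₀, hsat⟩ := exists_saturated_level h1 h2 hD hnd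
  refine ⟨M₀, hM₀, fun M hM hdvd n hn p hp hpg => ?_⟩
  obtain ⟨c, hc⟩ := hdvd
  have hg : 0 < n.gcd M := Nat.gcd_pos_of_pos_left M hn
  obtain ⟨a, b, hab, hna, hMb⟩ := Nat.exists_coprime n M
  generalize n.gcd M = g at *
  have ha : 0 < a := Nat.pos_of_mul_pos_right (hna ▸ hn)
  have hb : 0 < b := Nat.pos_of_mul_pos_right (hMb ▸ hM)
  rw [mul_comm] at hna
  subst hna
  rw [Nat.mul_div_cancel_left _ hg] at hpg
  refine mem_conjPairs_of_saturated (c := c) h2 hM₀ ?_ hg ha hb hab ?_ hsat hp hpg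
  · exact Nat.pos_of_mul_pos_left (hc ▸ hM)
  · rw [mul_comm, ← hMb, hc]

end LucasIndex

/-! ### Dependence of `K_n` and `C_n` on `gcd n M`, and the final assembly -/

namespace LucasIndex

open IntermediateField

variable {a₁ a₂ : ℤ}

theorem mem_conjPairs_iff {M n : ℕ} (h2 : a₂ ≠ 0) (hn : 0 < n)
    (hM : ∀ p ∈ rootPairs a₁ a₂ n, powPair (n / n.gcd M) p ∈ conjPairs a₁ a₂ (n.gcd M) →
      p ∈ conjPairs a₁ a₂ n) (p : ℂ × ℂ) :
    p ∈ conjPairs a₁ a₂ n ↔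
      p ∈ rootPairs a₁ a₂ n ∧ powPair (n / n.gcd M) p ∈ conjPairs a₁ a₂ (n.gcd M) := by
  refine ⟨fun hp => ⟨conjPairs_subset h2 hn hp, ?_⟩, fun hp => hM p hp.1 hp.2⟩
  obtain ⟨k, hk⟩ := Nat.gcd_dvd_left n M
  have hg : 0 < n.gcd M := Nat.gcd_pos_of_pos_left M hn
  generalize n.gcd M = g at *
  subst hk
  rw [Nat.mul_div_cancel_left _ hg]
  exact powPair_mem_conjPairs hg (Nat.pos_of_mul_pos_left hn) hp

theorem finrank_Kn_mul_psi {M n : ℕ} (h1 : a₁ ≠ 0) (h2 : a₂ ≠ 0) (hn : 0 < n)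
    (hM : ∀ p ∈ rootPairs a₁ a₂ n, powPair (n / n.gcd M) p ∈ conjPairs a₁ a₂ (n.gcd M) →
      p ∈ conjPairs a₁ a₂ n) :
    psi (n.gcd M) * Module.finrank ℚ (Kn a₁ a₂ n) =
      Module.finrank ℚ (Kn a₁ a₂ (n.gcd M)) * psi n := by
  have hiff := mem_conjPairs_iff h2 hn hM
  obtain ⟨k, hk⟩ := Nat.gcd_dvd_left n M
  have hg : 0 < n.gcd M := Nat.gcd_pos_of_pos_left M hn
  rw [← ncard_conjPairs h1 h2 hn, ← ncard_conjPairs h1 h2 hg, Set.ext hiff]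
  generalize n.gcd M = g at *
  subst hk
  rw [Nat.mul_div_cancel_left _ hg]
  exact ncard_powPair_preimage hg (Nat.pos_of_mul_pos_left hn) h2 (conjPairs_subset h2 hg)

theorem exists_inverting_iff {n : ℕ} (hn : 0 < n) :
    (∃ σ : Kn a₁ a₂ n ≃ₐ[ℚ] Kn a₁ a₂ n, σ (ζK a₁ a₂ n) = (ζK a₁ a₂ n)⁻¹ ∧
      σ (γrootK a₁ a₂ n) = (γrootK a₁ a₂ n)⁻¹) ↔
    ((ζ n)⁻¹, (γroot a₁ a₂ n)⁻¹) ∈ conjPairs a₁ a₂ n := by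
  constructor
  · rintro ⟨σ, h, h'⟩
    exact ⟨(Kn a₁ a₂ n).val.comp σ.toAlgHom,
      Prod.ext (congrArg Subtype.val h) (congrArg Subtype.val h')⟩
  · rintro ⟨φ, hφ⟩
    simp only [Prod.mk.injEq] at hφ
    have := finiteDimensional_Kn (a₁ := a₁) (a₂ := a₂) hn
    -- An embedding inverting the two generators maps `Kn` to itself, hence is an automorphism;
    -- normality of `Kn` is not needed.
    have hmem : ∀ x : Kn a₁ a₂ n, φ x ∈ Kn a₁ a₂ n := by
      rintro ⟨x, hx⟩
      induction hx using adjoin_induction with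
      | mem x hx =>
        rcases hx with hx | hx | hx
        · obtain rfl := hx
          rcases map_sqrtD φ (s := ⟨_, sqrtD_mem_Kn a₁ a₂ n⟩) rfl with h | h
          · exact (congrArg (· ∈ Kn a₁ a₂ n) h).mpr (sqrtD_mem_Kn a₁ a₂ n)
          · exact (congrArg (· ∈ Kn a₁ a₂ n) h).mpr (neg_mem (sqrtD_mem_Kn a₁ a₂ n))
        · obtain rfl := hx
          exact hφ.1 ▸ inv_mem (subset_adjoin _ _ (by simp))
        · obtain rfl := hx
          exact hφ.2 ▸ inv_mem (subset_adjoin _ _ (by simp))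
      | algebraMap x =>
        have : φ (algebraMap ℚ (Kn a₁ a₂ n) x) = algebraMap ℚ ℂ x := φ.commutes x
        exact (congrArg (· ∈ Kn a₁ a₂ n) this).mpr (IntermediateField.algebraMap_mem _ x)
      | add x y hx hy h h' => exact (map_add φ ⟨x, hx⟩ ⟨y, hy⟩) ▸ add_mem h h'
      | mul x y hx hy h h' => exact (map_mul φ ⟨x, hx⟩ ⟨y, hy⟩) ▸ mul_mem h h'
      | inv x hx h => exact (map_inv₀ φ ⟨x, hx⟩) ▸ inv_mem h
    let ψ : Kn a₁ a₂ n →ₐ[ℚ] Kn a₁ a₂ n := φ.codRestrict (Kn a₁ a₂ n).toSubalgebra hmem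
    have hbij : Function.Bijective ψ := Algebra.IsAlgebraic.algHom_bijective ψ
    exact ⟨AlgEquiv.ofBijective ψ hbij, Subtype.ext hφ.1, Subtype.ext hφ.2⟩

open scoped Classical in
theorem ncard_Cn (h1 : a₁ ≠ 0) (h2 : a₂ ≠ 0) (hnd : Nondegenerate a₁ a₂) {n : ℕ} (hn : 0 < n) :
    (Cn a₁ a₂ n).ncard =
      if ((ζ n)⁻¹, (γroot a₁ a₂ n)⁻¹) ∈ conjPairs a₁ a₂ n then 2 else 1 := by
  split_ifs with h
  · obtain ⟨σ, hσ⟩ := (exists_inverting_iff hn).2 h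
    have hset : Cn a₁ a₂ n = {1, σ} := by
      rw [Cn, Set.singleton_union]
      congr 1
      refine Set.eq_singleton_iff_unique_mem.2 ⟨hσ, fun τ hτ => ?_⟩
      have : (Kn a₁ a₂ n).val.comp τ.toAlgHom = (Kn a₁ a₂ n).val.comp σ.toAlgHom :=
        Kn_algHom_ext h1 h2 hn (congrArg Subtype.val (hτ.1.trans hσ.1.symm))
          (congrArg Subtype.val (hτ.2.trans hσ.2.symm))
      refine AlgEquiv.ext fun x => Subtype.ext ?_
      exact congrArg (fun f : Kn a₁ a₂ n →ₐ[ℚ] ℂ => f x) this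
    rw [hset, Set.ncard_pair]
    rintro rfl
    have h3 : γroot a₁ a₂ n = (γroot a₁ a₂ n)⁻¹ := congrArg Subtype.val hσ.2
    have h4 : γroot a₁ a₂ n ^ 2 = 1 := by
      rw [sq]
      nth_rw 2 [h3]
      exact mul_inv_cancel₀ (γroot_ne_zero h2 hn)
    refine hnd 2 two_pos ?_
    rw [← γroot_pow_self hn, pow_right_comm, h4, one_pow]
  · rw [← exists_inverting_iff hn] at h
    have hset : Cn a₁ a₂ n = {1} := by
      rw [Cn, Set.union_eq_left]
      exact fun σ hσ => absurd ⟨σ, hσ⟩ h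
    rw [hset, Set.ncard_singleton]

/-- The inverse pair is always a root pair, and it projects to the inverse pair of level `gcd n M`;
so the inverting automorphism exists at both levels or at neither. -/
theorem ncard_Cn_gcd {M n : ℕ} (h1 : a₁ ≠ 0) (h2 : a₂ ≠ 0) (hnd : Nondegenerate a₁ a₂)
    (hn : 0 < n)
    (hM : ∀ p ∈ rootPairs a₁ a₂ n, powPair (n / n.gcd M) p ∈ conjPairs a₁ a₂ (n.gcd M) →
      p ∈ conjPairs a₁ a₂ n) :
    (Cn a₁ a₂ n).ncard = (Cn a₁ a₂ (n.gcd M)).ncard := by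
  classical
  have hiff := mem_conjPairs_iff h2 hn hM
  have hinv : ((ζ n)⁻¹, (γroot a₁ a₂ n)⁻¹) ∈ rootPairs a₁ a₂ n :=
    ⟨(ζ_isPrimitiveRoot hn).inv, Or.inr (by rw [inv_pow, γroot_pow_self hn])⟩
  obtain ⟨k, hk⟩ := Nat.gcd_dvd_left n M
  have hg : 0 < n.gcd M := Nat.gcd_pos_of_pos_left M hn
  rw [ncard_Cn h1 h2 hnd hn, ncard_Cn h1 h2 hnd hg]
  refine if_congr ((hiff _).trans ((and_iff_right hinv).trans ?_)) rfl rfl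
  generalize n.gcd M = g at *
  subst hk
  have hk : 0 < k := Nat.pos_of_mul_pos_left hn
  rw [Nat.mul_div_cancel_left _ hg]
  simp only [powPair, inv_pow, ζ_pow hg hk, γroot_pow hk]

/-- There is a greatest `h` such that `γ` or `-γ` is an `h`-th power in `K`. -/
theorem exists_isGreatest_pow (h2 : a₂ ≠ 0) (hD : ¬ IsSquare (D a₁ a₂))
    (hnd : Nondegenerate a₁ a₂) :
    ∃ h : ℕ, IsGreatest {h : ℕ | ∃ c ∈ K a₁ a₂, c ^ h = γ a₁ a₂ ∨ c ^ h = -γ a₁ a₂} h := by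
  obtain ⟨B, hB⟩ := exists_bound_pow_eq h2 hD hnd
  have hne : {h : ℕ | ∃ c ∈ K a₁ a₂, c ^ h = γ a₁ a₂ ∨ c ^ h = -γ a₁ a₂}.Nonempty :=
    ⟨1, γ a₁ a₂, γ_mem (subset_adjoin _ _ rfl), Or.inl (pow_one _)⟩
  have hbdd : BddAbove {h : ℕ | ∃ c ∈ K a₁ a₂, c ^ h = γ a₁ a₂ ∨ c ^ h = -γ a₁ a₂} := by
    refine ⟨B, ?_⟩
    rintro h ⟨c, hc, hch⟩
    rcases Nat.eq_zero_or_pos h with rfl | hh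
    · exact Nat.zero_le B
    -- The even exponent 24 absorbs the sign in `±γ`.
    refine hB h hh (c ^ 24) (pow_mem hc 24) ?_
    rw [pow_right_comm]
    rcases hch with e | e <;> rw [e]
    exact Even.neg_pow (by decide) _
  exact ⟨_, Nat.sSup_mem hne hbdd, fun k hk => le_csSup hbdd hk⟩

/-- The series of `δ` and its value, for an arbitrary `h` in place of the exponent of `γ`. -/
theorem exists_periodic_δ (h1 : a₁ ≠ 0) (h2 : a₂ ≠ 0) (hD : ¬ IsSquare (D a₁ a₂))
    (hnd : Nondegenerate a₁ a₂) {h : ℕ} (hh : 0 < h) :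
    ∃ G : ℕ → ℚ, (∃ T : ℕ, 0 < T ∧ Function.Periodic G T) ∧ ∀ t : ℕ, 0 < t →
      HasSum (δterm a₁ a₂ t) (artinConstant * F (2 * h) t * (G t : ℝ)) := by
  obtain ⟨M₀, hM₀, hlevel⟩ := exists_level h1 h2 hD hnd
  -- A multiple of `M₀` for the Kummer theory, and of `2 h` so that the factors of `F (2 * h)` at
  -- primes dividing the modulus are periodic.
  have hM : 0 < 2 * h * M₀ := by positivity
  have hlev := hlevel (2 * h * M₀) hM (Dvd.intro_left _ rfl)
  obtain ⟨G, hG, hsum⟩ := exists_periodic_moebius_sum hM (by positivity : 0 < 2 * h)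
    (Dvd.intro _ rfl) (by rw [mul_assoc]; exact Dvd.intro _ rfl)
    fun g => ((Cn a₁ a₂ g).ncard * psi g : ℚ) / Module.finrank ℚ (Kn a₁ a₂ g)
  refine ⟨G, ⟨_, hM, hG⟩, fun t ht => ?_⟩
  refine (congrArg (HasSum · _) (funext fun n => ?_)).mpr (hsum t ht)
  rcases Nat.eq_zero_or_pos n with rfl | hn
  · simp [δterm]
  have hnt := Nat.mul_pos hn ht
  have hg : 0 < (n * t).gcd (2 * h * M₀) := Nat.gcd_pos_of_pos_left _ hnt
  have hC := ncard_Cn_gcd h1 h2 hnd hnt (hlev _ hnt)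
  have hK := finrank_Kn_mul_psi h1 h2 hnt (hlev _ hnt)
  have hpos : ∀ m : ℕ, 0 < m → (Module.finrank ℚ (Kn a₁ a₂ m) : ℝ) ≠ 0 := by
    intro m hm
    have := finiteDimensional_Kn (a₁ := a₁) (a₂ := a₂) hm
    exact_mod_cast Module.finrank_pos.ne'
  have hp1 := hpos _ hnt
  have hp2 := hpos _ hg
  have hp3 : (psi (n * t) : ℝ) ≠ 0 := by exact_mod_cast (psi_pos hnt).ne'
  have hK' : (psi ((n * t).gcd (2 * h * M₀)) * Module.finrank ℚ (Kn a₁ a₂ (n * t)) : ℝ) =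
      Module.finrank ℚ (Kn a₁ a₂ ((n * t).gcd (2 * h * M₀))) * psi (n * t) := by
    exact_mod_cast hK
  unfold δterm
  rw [hC]
  push_cast
  rw [mul_div_assoc]
  congr 1
  rw [div_div, div_eq_div_iff hp1 (mul_ne_zero hp2 hp3), ← hK']
  ring

end LucasIndex

theorem theorem1p2 (a₁ a₂ : ℤ) (u : ℕ → ℤ) (hu : LucasIndex.IsLucasSequence a₁ a₂ u)
    (hnd : LucasIndex.Nondegenerate a₁ a₂)
    (hD : ¬ IsSquare (LucasIndex.D a₁ a₂))
    (h3 : NumberField.discr (LucasIndex.K a₁ a₂) ≠ -3)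
    (h4 : NumberField.discr (LucasIndex.K a₁ a₂) ≠ -4) :
    (∀ t : ℕ, 0 < t → Summable (LucasIndex.δterm a₁ a₂ t)) ∧
    ∃ h : ℕ, 0 < h ∧ (LucasIndex.F (2 * h)).IsMultiplicative ∧
      ∃ G : ℕ → ℚ, (∃ T : ℕ, 0 < T ∧ Function.Periodic G T) ∧
        ∀ t : ℕ, 0 < t →
          LucasIndex.δ a₁ a₂ t = LucasIndex.artinConstant * LucasIndex.F (2 * h) t * (G t : ℝ) := by
  have h1 := hu.a₁_ne_zero
  have h2 := hu.a₂_ne_zero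
  obtain ⟨h, -, hmax⟩ := LucasIndex.exists_isGreatest_pow h2 hD hnd
  -- The exponent 1 is admissible, so the greatest one is at least 1.
  have hh : 0 < h := hmax ⟨LucasIndex.γ a₁ a₂,
    LucasIndex.γ_mem (IntermediateField.subset_adjoin _ _ rfl), Or.inl (pow_one _)⟩
  obtain ⟨G, hG, hsum⟩ := LucasIndex.exists_periodic_δ h1 h2 hD hnd hh
  exact ⟨fun t ht => (hsum t ht).summable, h, hh,
    LucasIndex.F_isMultiplicative (by positivity), G, hG, fun t ht => (hsum t ht).tsum_eq⟩
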